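/- Consider the Gerdjikov–Ivanov (GI) equation for $q=q(x,t)$, $(x,t)\in\mathbb{R}^2$, $$iq_t+q_{xx}-iq^2\bar q_x+\tfrac12 q^3\bar q^2=0 ,\qquad (1)$$ and write $\sigma_2=\begin{pmatrix}0&-i\\ i&0\end{pmatrix}$, $\sigma_3=\begin{pmatrix}1&0\\0&-1\end{pmatrix}$, $Q=\begin{pmatrix}0&q\\-\bar q&0\end{pmatrix}$, $$U=kQ-\tfrac i2Q^2\sigma_3,\qquad V=2k^3Q-ik^2Q^2\sigma_3-ikQ_x\sigma_3+\tfrac12(Q_xQ-QQ_x)+\tfrac i4Q^4\sigma_3 .$$ Let $N$ be a positive integer and let $k_1,\dots,k_N$, $b_1,\dots,b_N$ be nonzero complex constants such that $k_j^2\ne k_l^2$ for $j\ne l$ and $k_j^2\neq\bar k_l^2$ for all $j,l$ (that is, the points $\pm k_j,\pm\bar k_j$, $1\le j\le N$, are pairwise distinct). Let $q_0$ be a smooth solution of (1) on $\mathbb{R}^2$. Let $S\subseteq\mathbb{C}$ be a set of spectral parameters that contains all $k_j$ and is invariant under $k\mapsto-k$ and $k\mapsto\bar k$ (for example $S=\mathbb{C}$),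 and let $\psi_0(x,t,k)$, $k\in S$, be an associated eigenfunction, i.e. a $2\times2$ matrix function, smooth in $(x,t)$, with $$\psi_{0,x}+ik^2\sigma_3\psi_0=U\psi_0,\qquad \psi_{0,t}+2ik^4\sigma_3\psi_0=V\psi_0$$ where $U,V$ are formed with $q=q_0$, which is invertible and obeys the symmetries $$\sigma_3\psi_0(x,t,-k)\sigma_3=\psi_0(x,t,k),\qquad \psi_0^{-1}(x,t,k)=\psi_0^\dagger(x,t,\bar k)\qquad(k\in S).$$ Put $$a_j=\frac{2k_j}{k_j^2-\bar k_j^2}\prod_{m\ne j}\frac{k_j^2-k_m^2}{k_j^2-\bar k_m^2},\qquad P_j=\begin{pmatrix}r_j\\ s_j\end{pmatrix}(b_j,b_j^{-1})\,\psi_0^{-1}(x,t,k_j),\qquad u_l=\sigma_2\overline{\psi_0(x,t,k_l)}\begin{pmatrix}\bar b_l^{-1}\\-\bar b_l\end{pmatrix}.$$ Then for every $(x,t)\in\mathbb{R}^2$ the linear algebraic system $$u_l+\sum_{j=1}^N\frac1{a_j}\left[\frac{1}{\bar k_l-k_j}P_j-\frac{1}{\bar k_l+k_j}\sigma_3P_j\sigma_3\right]u_l=0,\qquad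 l=1,\dots,N,$$ has a unique solution $\{r_j(x,t),s_j(x,t)\}_{j=1}^N$, and with the functions $r_j,s_j$ so determined and $A_j=\frac1{a_j}P_j$, the function $$q(x,t)=q_0(x,t)+4i\sum_{j=1}^N (A_j)_{12}$$ is again a smooth solution of (1) on $\mathbb{R}^2$. -/

import Mathlib

open scoped ComplexConjugate Matrix ContDiff

namespace GerdjikovIvanov

noncomputable section

/-- The partial derivative of `f(x,t)` with respect to `x`. -/
def dx (f : ℝ → ℝ → ℂ) (x t : ℝ) : ℂ := deriv (fun y => f y t) x

/-- The partial derivative of `f(x,t)` with respect to `t`. -/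
def dt (f : ℝ → ℝ → ℂ) (x t : ℝ) : ℂ := deriv (fun s => f x s) t

/-- `q` is a smooth solution on `ℝ × ℝ` of the Gerdjikov–Ivanov equation
`i q_t + q_xx - i q² q̄_x + ½ q³ q̄² = 0`. -/
structure IsGISolution (q : ℝ → ℝ → ℂ) : Prop where
  smooth : ContDiff ℝ ∞ (fun p : ℝ × ℝ => q p.1 p.2)
  equation : ∀ x t : ℝ,
    Complex.I * dt q x t + dx (dx q) x t
      - Complex.I * q x t ^ 2 * dx (fun y s => conj (q y s)) x t
      + (1 / 2 : ℂ) * q x t ^ 3 * conj (q x t) ^ 2 = 0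

def σ₂ : Matrix (Fin 2) (Fin 2) ℂ := !![0, -Complex.I; Complex.I, 0]

def σ₃ : Matrix (Fin 2) (Fin 2) ℂ := !![1, 0; 0, -1]

/-- The potential matrix `Q` built from `q`. -/
def potQ (q : ℝ → ℝ → ℂ) (x t : ℝ) : Matrix (Fin 2) (Fin 2) ℂ :=
  !![0, q x t; -conj (q x t), 0]

/-- The entrywise derivative `Q_x`. -/
def potQx (q : ℝ → ℝ → ℂ) (x t : ℝ) : Matrix (Fin 2) (Fin 2) ℂ :=
  Matrix.of fun i j => dx (fun y s => potQ q y s i j) x t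

/-- `U = k Q - (i/2) Q² σ₃`. -/
def laxU (q : ℝ → ℝ → ℂ) (x t : ℝ) (k : ℂ) : Matrix (Fin 2) (Fin 2) ℂ :=
  k • potQ q x t - (Complex.I / 2) • (potQ q x t ^ 2 * σ₃)

/-- `V = 2k³ Q - i k² Q² σ₃ - i k Q_x σ₃ + ½ (Q_x Q - Q Q_x) + (i/4) Q⁴ σ₃`. -/
def laxV (q : ℝ → ℝ → ℂ) (x t : ℝ) (k : ℂ) : Matrix (Fin 2) (Fin 2) ℂ :=
  (2 * k ^ 3) • potQ q x t - (Complex.I * k ^ 2) • (potQ q x t ^ 2 * σ₃)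
    - (Complex.I * k) • (potQx q x t * σ₃)
    + (1 / 2 : ℂ) • (potQx q x t * potQ q x t - potQ q x t * potQx q x t)
    + (Complex.I / 4) • (potQ q x t ^ 4 * σ₃)

/-- For every spectral parameter `k ∈ S`, the matrix function `ψ(·,·,k)` is smooth in `(x,t)` and
solves `ψ_x + i k² σ₃ ψ = U ψ`, `ψ_t + 2 i k⁴ σ₃ ψ = V ψ`, with `U`, `V` built from `q`. -/
structure IsEigenfunction (q : ℝ → ℝ → ℂ) (S : Set ℂ)
    (ψ : ℝ → ℝ → ℂ → Matrix (Fin 2) (Fin 2) ℂ) : Prop where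
  smooth : ∀ k ∈ S, ∀ i j : Fin 2, ContDiff ℝ ∞ (fun p : ℝ × ℝ => ψ p.1 p.2 k i j)
  eq_x : ∀ k ∈ S, ∀ x t : ℝ,
    (Matrix.of fun i j => dx (fun y s => ψ y s k i j) x t)
      + (Complex.I * k ^ 2) • (σ₃ * ψ x t k) = laxU q x t k * ψ x t k
  eq_t : ∀ k ∈ S, ∀ x t : ℝ,
    (Matrix.of fun i j => dt (fun y s => ψ y s k i j) x t)
      + (2 * Complex.I * k ^ 4) • (σ₃ * ψ x t k) = laxV q x t k * ψ x t k

/-- The set `S` of spectral parameters is invariant under `k ↦ -k` and `k ↦ k̄`, and on it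
`σ₃ ψ(x,t,-k) σ₃ = ψ(x,t,k)` and `ψ⁻¹(x,t,k) = ψ†(x,t,k̄)` (in particular `ψ(x,t,k)` is
invertible). -/
structure HasSymmetries (S : Set ℂ) (ψ : ℝ → ℝ → ℂ → Matrix (Fin 2) (Fin 2) ℂ) : Prop where
  neg_mem : ∀ k ∈ S, -k ∈ S
  conj_mem : ∀ k ∈ S, conj k ∈ S
  reflection : ∀ k ∈ S, ∀ x t : ℝ, σ₃ * ψ x t (-k) * σ₃ = ψ x t k
  invertible : ∀ k ∈ S, ∀ x t : ℝ, IsUnit (ψ x t k)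
  inverse : ∀ k ∈ S, ∀ x t : ℝ, (ψ x t k)⁻¹ = (ψ x t (conj k))ᴴ

variable {N : ℕ}

/-- `a_j = (2 k_j / (k_j² - k̄_j²)) ∏_{m ≠ j} (k_j² - k_m²) / (k_j² - k̄_m²)`. -/
def coeffA (k : Fin N → ℂ) (j : Fin N) : ℂ :=
  2 * k j / (k j ^ 2 - conj (k j) ^ 2)
    * ∏ m ∈ Finset.univ.erase j, (k j ^ 2 - k m ^ 2) / (k j ^ 2 - conj (k m) ^ 2)

/-- The product `(r, s)ᵀ (b, b⁻¹) M⁻¹` of a column, a row and the inverse of a matrix. -/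
def rankOne (r s b : ℂ) (M : Matrix (Fin 2) (Fin 2) ℂ) : Matrix (Fin 2) (Fin 2) ℂ :=
  Matrix.vecMulVec ![r, s] ![b, b⁻¹] * M⁻¹

/-- The residue `A_j(x,t) = (1/a_j) (r_j, s_j)ᵀ (b_j, b_j⁻¹) ψ₀⁻¹(x,t,k_j)`, where `r`, `s` are the
values of the unknowns at `(x,t)`. -/
def residueA (k b : Fin N → ℂ) (ψ₀ : ℝ → ℝ → ℂ → Matrix (Fin 2) (Fin 2) ℂ)
    (r s : Fin N → ℂ) (x t : ℝ) (j : Fin N) : Matrix (Fin 2) (Fin 2) ℂ :=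
  (1 / coeffA k j) • rankOne (r j) (s j) (b j) (ψ₀ x t (k j))

/-- The vector `σ₂ \overline{ψ₀(x,t,k_l)} (b̄_l⁻¹, -b̄_l)ᵀ`. -/
def kernelVec (k b : Fin N → ℂ) (ψ₀ : ℝ → ℝ → ℂ → Matrix (Fin 2) (Fin 2) ℂ)
    (x t : ℝ) (l : Fin N) : Fin 2 → ℂ :=
  σ₂ *ᵥ ((ψ₀ x t (k l)).map conj *ᵥ ![(conj (b l))⁻¹, -conj (b l)])

/-- The linear algebraic system at `(x,t)` for the unknowns `r_j, s_j`, `j = 1, …, N`: with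
`u_l = σ₂ \overline{ψ₀(x,t,k_l)} (b̄_l⁻¹, -b̄_l)ᵀ` and `P_j = (r_j, s_j)ᵀ (b_j, b_j⁻¹) ψ₀⁻¹(x,t,k_j)`,
`u_l + ∑_j (1/a_j) [P_j / (k̄_l - k_j) - σ₃ P_j σ₃ / (k̄_l + k_j)] u_l = 0` for every `l`. -/
def SolvesSystem (k b : Fin N → ℂ) (ψ₀ : ℝ → ℝ → ℂ → Matrix (Fin 2) (Fin 2) ℂ)
    (x t : ℝ) (r s : Fin N → ℂ) : Prop :=
  ∀ l : Fin N,
    kernelVec k b ψ₀ x t l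
      + (∑ j : Fin N, (1 / coeffA k j) •
          ((1 / (conj (k l) - k j)) • rankOne (r j) (s j) (b j) (ψ₀ x t (k j))
            - (1 / (conj (k l) + k j)) •
                (σ₃ * rankOne (r j) (s j) (b j) (ψ₀ x t (k j)) * σ₃)))
        *ᵥ kernelVec k b ψ₀ x t l = 0

end

end GerdjikovIvanov

/-!
# Dressing solutions of the Gerdjikov–Ivanov equation

Up to a nonzero scalar, `u_l` is the Hermitian adjoint of the row `v_l = (b_l, b_l⁻¹) ψ₀⁻¹(k_l)`
(`kernelVec_eq`). The linear system therefore says that the Darboux matrix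
`D(k) = 1 + ∑ j, (A_j / (k - k_j) - σ₃ A_j σ₃ / (k + k_j))` satisfies `D(k̄_l) v_l† = 0`. Counting the
poles `±k_j` with rows `v_j`, `v_j σ₃` separately, it is the reflection-invariant part of a dressing
problem `D(κ̄_l) w_l† = 0` with simple poles `κ_i` and residues `β_i w_i` (`IsDressing`).

*Unique solvability.* The matrix of the problem is `w_i w_l† / (κ̄_l - κ_i)`. If `c` is in its kernel
and `f(k) = ∑ i, c_i w_i / (k - κ_i)`, then splitting `f(k) f(k̄)†` into partial fractions shows that
it vanishes; on the real axis it is `|f|²`, so `f = 0` and `c = 0`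
(`cauchyMatrix_mulVec_eq_zero`). Uniqueness makes the solution invariant under the reflection
`k ↦ -k` (`dressingCol_eq_colPair`), and Cramer's rule makes it smooth (`contDiff_dressingCol`).

*The dressed Lax pair.* Let the rows evolve by `w_i' = -w_i A₀(κ_i)` with a polynomial `A₀` that
satisfies `A₀(k̄)† = -A₀(k)`, and let `A` be the polynomial part at infinity of `D A₀ D⁻¹`. Then
`D' + D A₀ - A D` has only simple fractions with rows `w_i`, and it annihilates `w_l†` at `κ̄_l`, so by
injectivity it vanishes: `β_i' = A(κ_i) β_i` (`IsDressing.hasDerivAt`). Only the values of `ψ₀` at the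
points `k̄_j` enter. Consequently the moments `m n = ∑ i, κ_i ^ n β_i w_i`, the coefficients of `D` at
infinity, obey explicit differential equations in `x` and `t`.

*The equation.* The moments are alternately off-diagonal and diagonal by the reflection symmetry, and
`m 0` is anti-Hermitian (`IsDressing.conj_moment_zero`), so that `q₀ + 2 i (m 0)₁₂` and its conjugate
are the entries of the dressed potential. Twice `k²` times the dressed `x`-part agrees with the
dressed `t`-part up to a linear polynomial in `k`, which lets one express `∂ₜ (m 0)` by `∂ₓ (m 2)` and
lower moments (`dressT_evol`). Inserting this and the `x`-equations of `m 0` and `m 1` in the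
Gerdjikov–Ivanov equation leaves a polynomial identity (`gi_identity`).
-/

namespace GerdjikovIvanov

/-! ### Cauchy matrices of row vectors -/

section Cauchy

variable {ι : Type*} [Fintype ι]

/-- Simple fractions with distinct nonreal poles are linearly independent on the real line. -/
theorem partialFraction_eq_zero [DecidableEq ι] {κ : ι → ℂ} (hκ : Function.Injective κ)
    (hr : ∀ i, ∀ x : ℝ, (x : ℂ) - κ i ≠ 0) {g : ι → ℂ}
    (h : ∀ x : ℝ, ∑ i, g i / ((x : ℂ) - κ i) = 0) (i : ι) : g i = 0 := by
  set p : Polynomial ℂ := ∑ i, Polynomial.C (g i) *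
    ∏ j ∈ Finset.univ.erase i, (Polynomial.X - Polynomial.C (κ j)) with hp
  have hp0 : p = 0 := by
    apply Polynomial.eq_zero_of_infinite_isRoot
    refine Set.Infinite.mono ?_ (Set.infinite_range_of_injective Complex.ofReal_injective)
    rintro _ ⟨x, rfl⟩
    have : p.eval (x : ℂ) = (∏ j, ((x : ℂ) - κ j)) * ∑ i, g i / ((x : ℂ) - κ i) := by
      rw [hp, Polynomial.eval_finsetSum, Finset.mul_sum]
      refine Finset.sum_congr rfl fun i _ => ?_
      rw [← Finset.mul_prod_erase _ _ (Finset.mem_univ i)]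
      simp only [Polynomial.eval_mul, Polynomial.eval_C, Polynomial.eval_prod, Polynomial.eval_sub,
        Polynomial.eval_X]
      field_simp [hr i x]
    simp only [Set.mem_ofPred_eq, Polynomial.IsRoot.def, this, h x, mul_zero]
  have he : p.eval (κ i) = g i * ∏ j ∈ Finset.univ.erase i, (κ i - κ j) := by
    rw [hp, Polynomial.eval_finsetSum, Finset.sum_eq_single i]
    · simp [Polynomial.eval_prod]
    · intro j _ hj
      rw [Polynomial.eval_mul, Polynomial.eval_prod,
        Finset.prod_eq_zero (Finset.mem_erase.2 ⟨hj.symm, Finset.mem_univ i⟩) (by simp), mul_zero]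
    · simp
  rw [hp0, Polynomial.eval_zero] at he
  refine (mul_eq_zero.1 he.symm).resolve_right (Finset.prod_ne_zero_iff.2 fun j hj => ?_)
  exact sub_ne_zero.2 fun hij => (Finset.ne_of_mem_erase hj) (hκ hij).symm

/-- The Cauchy-type matrix `⟨w_i, w_l⟩ / (κ̄_l - κ_i)` (row `l`, column `i`) attached to poles `κ_i`
and row vectors `w_i`, where `⟨w_i, w_l⟩ = w_i w_l†`. -/
noncomputable def cauchyMatrix (κ : ι → ℂ) (w : ι → Fin 2 → ℂ) : Matrix ι ι ℂ :=
  Matrix.of fun l i => (w i ⬝ᵥ star (w l)) / (conj (κ l) - κ i)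

/-- If `c` is in the kernel, the vector `∑ i, c_i w_i / (x - κ_i)` has norm zero at every real `x`,
by partial fractions. No sign condition on the imaginary parts of the `κ_i` is needed. -/
theorem cauchyMatrix_mulVec_eq_zero {κ : ι → ℂ} {w : ι → Fin 2 → ℂ} (hκ : Function.Injective κ)
    (hκc : ∀ i l, κ i ≠ conj (κ l)) (hw : ∀ i, w i ≠ 0) {c : ι → ℂ}
    (h : cauchyMatrix κ w *ᵥ c = 0) : c = 0 := by
  classical
  have hl : ∀ l, ∑ i, (w i ⬝ᵥ star (w l)) / (conj (κ l) - κ i) * c i = 0 := fun l => congrFun h l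
  have hr : ∀ i, ∀ x : ℝ, (x : ℂ) - κ i ≠ 0 := by
    intro i x hx
    apply hκc i i
    rw [← sub_eq_zero.1 hx, Complex.conj_ofReal]
  have hr' : ∀ i, ∀ x : ℝ, (x : ℂ) - conj (κ i) ≠ 0 := by
    intro i x hx
    apply hr i x
    have := congrArg conj hx
    simpa using this
  have hF : ∀ (x : ℝ) (a : Fin 2), ∑ i, c i * w i a / ((x : ℂ) - κ i) = 0 := by
    intro x
    have key : ∑ a, (∑ i, c i * w i a / ((x : ℂ) - κ i)) *
        conj (∑ i, c i * w i a / ((x : ℂ) - κ i)) = 0 := by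
      -- `1 / ((x - κ_i)(x - κ̄_l)) = (1 / (x - κ_i) - 1 / (x - κ̄_l)) / (κ_i - κ̄_l)`
      have e1 : ∑ a, (∑ i, c i * w i a / ((x : ℂ) - κ i)) *
          conj (∑ i, c i * w i a / ((x : ℂ) - κ i)) =
          ∑ l, conj (c l) / ((x : ℂ) - conj (κ l)) *
            (∑ i, (w i ⬝ᵥ star (w l)) / (conj (κ l) - κ i) * c i) -
          ∑ i, c i / ((x : ℂ) - κ i) *
            (conj (∑ l, (w l ⬝ᵥ star (w i)) / (conj (κ i) - κ l) * c l) * -1) := by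
        simp only [map_sum, Finset.sum_mul_sum]
        rw [Finset.sum_comm]
        simp only [Finset.mul_sum, Finset.sum_mul]
        rw [Finset.sum_comm (γ := ι) (f := fun l i => conj (c l) / _ * _),
          ← Finset.sum_sub_distrib]
        refine Finset.sum_congr rfl fun i _ => ?_
        rw [Finset.sum_comm, ← Finset.sum_sub_distrib]
        refine Finset.sum_congr rfl fun l _ => ?_
        have h1 := hr i x
        have h2 := hr' l x
        have h3 : conj (κ l) - κ i ≠ 0 := sub_ne_zero.2 (hκc i l).symm
        have h4 : κ i - conj (κ l) ≠ 0 := sub_ne_zero.2 (hκc i l)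
        simp only [dotProduct, Fin.sum_univ_two, map_mul, map_div₀, map_add, map_sub, Pi.star_apply,
          RCLike.star_def, Complex.conj_conj, Complex.conj_ofReal]
        field_simp
        ring
      rw [e1]
      simp only [hl, map_zero, mul_zero, zero_mul, Finset.sum_const_zero, sub_zero]
    rw [Fin.sum_univ_two, Complex.mul_conj, Complex.mul_conj, ← Complex.ofReal_add,
      Complex.ofReal_eq_zero, add_eq_zero_iff_of_nonneg (Complex.normSq_nonneg _)
      (Complex.normSq_nonneg _), Complex.normSq_eq_zero, Complex.normSq_eq_zero] at key
    intro a
    fin_cases a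
    exacts [key.1, key.2]
  funext i
  obtain ⟨a, ha⟩ := Function.ne_iff.1 (hw i)
  exact (mul_eq_zero.1 (partialFraction_eq_zero hκ hr (fun x => hF x a) i)).resolve_right ha

theorem isUnit_cauchyMatrix [DecidableEq ι] {κ : ι → ℂ} {w : ι → Fin 2 → ℂ}
    (hκ : Function.Injective κ) (hκc : ∀ i l, κ i ≠ conj (κ l)) (hw : ∀ i, w i ≠ 0) :
    IsUnit (cauchyMatrix κ w) := by
  rw [← Matrix.mulVec_injective_iff_isUnit]
  intro c c' h
  rw [← sub_eq_zero]
  apply cauchyMatrix_mulVec_eq_zero hκ hκc hw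
  rw [Matrix.mulVec_sub, sub_eq_zero]
  exact h

end Cauchy

/-! ### The dressing problem and its reflection symmetry -/

section Dressing

variable {ι : Type*} [Fintype ι]

/-- The columns `β_i` dress the rows `w_i` at the poles `κ_i`: the Darboux matrix
`D(k) = 1 + ∑ i, β_i w_i / (k - κ_i)` satisfies `D(κ̄_l) w_l† = 0` for every `l`. -/
def IsDressing (κ : ι → ℂ) (w β : ι → Fin 2 → ℂ) : Prop :=
  ∀ l, star (w l) + ∑ i, ((w i ⬝ᵥ star (w l)) / (conj (κ l) - κ i)) • β i = 0

/-- The columns that dress `w` at `κ`, obtained by inverting the Cauchy matrix. -/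
noncomputable def dressingCol [DecidableEq ι] (κ : ι → ℂ) (w : ι → Fin 2 → ℂ) (i : ι) (a : Fin 2) :
    ℂ :=
  -((cauchyMatrix κ w)⁻¹ *ᵥ fun l => conj (w l a)) i

theorem isDressing_iff_mulVec {κ : ι → ℂ} {w β : ι → Fin 2 → ℂ} :
    IsDressing κ w β ↔
      ∀ a, cauchyMatrix κ w *ᵥ (fun i => β i a) = -fun l => conj (w l a) := by
  have e : ∀ l a, (star (w l) + ∑ i, ((w i ⬝ᵥ star (w l)) / (conj (κ l) - κ i)) • β i) a =
      conj (w l a) + (cauchyMatrix κ w *ᵥ fun i => β i a) l := by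
    intro l a
    simp [Matrix.mulVec, dotProduct, cauchyMatrix, Finset.sum_apply]
  constructor
  · intro h a
    funext l
    have := congrFun (h l) a
    rw [e] at this
    exact eq_neg_of_add_eq_zero_right this
  · intro h l
    funext a
    rw [e, h a]
    simp

theorem isDressing_iff_eq [DecidableEq ι] {κ : ι → ℂ} {w β : ι → Fin 2 → ℂ}
    (hκ : Function.Injective κ) (hκc : ∀ i l, κ i ≠ conj (κ l)) (hw : ∀ i, w i ≠ 0) :
    IsDressing κ w β ↔ β = dressingCol κ w := by
  have hu := (Matrix.isUnit_iff_isUnit_det _).1 (isUnit_cauchyMatrix hκ hκc hw)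
  rw [isDressing_iff_mulVec]
  constructor
  · intro h
    funext i a
    have := congrArg (fun u => ((cauchyMatrix κ w)⁻¹ *ᵥ u) i) (h a)
    simpa [Matrix.mulVec_mulVec, Matrix.nonsing_inv_mul _ hu, Matrix.mulVec_neg, dressingCol]
      using this
  · rintro rfl a
    have : (fun i => dressingCol κ w i a) = -((cauchyMatrix κ w)⁻¹ *ᵥ fun l => conj (w l a)) := rfl
    rw [this, Matrix.mulVec_neg, Matrix.mulVec_mulVec, Matrix.mul_nonsing_inv _ hu,
      Matrix.one_mulVec]

theorem contDiff_dressingCol [DecidableEq ι] {E : Type*} [NormedAddCommGroup E] [NormedSpace ℝ E]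
    {κ : ι → ℂ} {w : E → ι → Fin 2 → ℂ} (hκ : Function.Injective κ)
    (hκc : ∀ i l, κ i ≠ conj (κ l)) (hw : ∀ p i, w p i ≠ 0)
    (hs : ∀ i a, ContDiff ℝ ∞ fun p => w p i a) (i : ι) (a : Fin 2) :
    ContDiff ℝ ∞ fun p => dressingCol κ (w p) i a := by
  have hc : ∀ i a, ContDiff ℝ ∞ fun p => conj (w p i a) := fun i a =>
    Complex.conjCLE.contDiff.comp (hs i a)
  have hC : ∀ l i, ContDiff ℝ ∞ fun p => cauchyMatrix κ (w p) l i := by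
    intro l i
    simp only [cauchyMatrix, Matrix.of_apply, dotProduct, Fin.sum_univ_two, Pi.star_apply,
      RCLike.star_def]
    exact (((hs i 0).mul (hc l 0)).add ((hs i 1).mul (hc l 1))).div_const _
  have hdet : ∀ B : E → Matrix ι ι ℂ, (∀ l i, ContDiff ℝ ∞ fun p => B p l i) →
      ContDiff ℝ ∞ fun p => (B p).det := by
    intro B hB
    simp only [Matrix.det_apply']
    exact ContDiff.sum fun σ _ => contDiff_const.mul (contDiff_prod fun i _ => hB _ _)
  have hne : ∀ p, (cauchyMatrix κ (w p)).det ≠ 0 := fun p =>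
    ((Matrix.isUnit_iff_isUnit_det _).1 (isUnit_cauchyMatrix hκ hκc (hw p))).ne_zero
  have e : ∀ p, dressingCol κ (w p) i a = -((cauchyMatrix κ (w p)).det⁻¹ *
      ((cauchyMatrix κ (w p)).updateCol i fun l => conj (w p l a)).det) := by
    intro p
    rw [← Matrix.cramer_apply, dressingCol, Matrix.inv_def, Matrix.smul_mulVec,
      Matrix.cramer_eq_adjugate_mulVec, Ring.inverse_eq_inv', Pi.smul_apply, smul_eq_mul]
  simp only [e]
  refine (((hdet _ hC).inv hne).mul (hdet _ fun l j => ?_)).neg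
  by_cases h : j = i
  · subst h
    simpa using hc l a
  · simpa [Matrix.updateCol_apply, h] using hC l j

end Dressing

section Reflection

variable {N : ℕ}

/-- The poles `±k_j`. -/
def polePair (k : Fin N → ℂ) : Fin N ⊕ Fin N → ℂ := Sum.elim k fun j => -k j

/-- The rows `v_j` at `k_j` and `v_j σ₃` at `-k_j`. -/
noncomputable def rowPair (v : Fin N → Fin 2 → ℂ) : Fin N ⊕ Fin N → Fin 2 → ℂ :=
  Sum.elim v fun j => v j ᵥ* σ₃

/-- The columns `α_j` at `k_j` and `-σ₃ α_j` at `-k_j`. -/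
noncomputable def colPair (α : Fin N → Fin 2 → ℂ) : Fin N ⊕ Fin N → Fin 2 → ℂ :=
  Sum.elim α fun j => -(σ₃ *ᵥ α j)

theorem injective_polePair {k : Fin N → ℂ} (hk0 : ∀ j, k j ≠ 0)
    (hk : ∀ j l, j ≠ l → k j ^ 2 ≠ k l ^ 2) : Function.Injective (polePair k) := by
  have h : ∀ j l, k j ^ 2 = k l ^ 2 → j = l := fun j l e => by
    by_contra hjl
    exact hk j l hjl e
  have h2 : ∀ j l, k j ≠ -k l := by
    intro j l e
    obtain rfl := h j l (by rw [e]; ring)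
    apply hk0 j
    linear_combination (1 / 2 : ℂ) * e
  rintro (i | i) (j | j) e
  · simp only [polePair, Sum.elim_inl] at e
    rw [h i j (by rw [e])]
  · exact absurd e (h2 i j)
  · exact absurd e.symm (h2 j i)
  · simp only [polePair, Sum.elim_inr] at e
    rw [h i j (by rw [neg_inj.1 e])]

theorem polePair_ne_conj {k : Fin N → ℂ} (hkc : ∀ j l, k j ^ 2 ≠ conj (k l) ^ 2)
    (i l : Fin N ⊕ Fin N) : polePair k i ≠ conj (polePair k l) := by
  have h : ∀ i, ∃ j, ∀ z, polePair k i = z → k j ^ 2 = z ^ 2 := by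
    rintro (j | j) <;> refine ⟨j, fun z hz => ?_⟩ <;> rw [← hz] <;> simp [polePair]
  have h' : ∀ i, ∃ j, conj (k j) ^ 2 = conj (polePair k i) ^ 2 := by
    rintro (j | j) <;> refine ⟨j, ?_⟩ <;> simp [polePair]
  intro e
  obtain ⟨j, hj⟩ := h i
  obtain ⟨m, hm⟩ := h' l
  exact hkc j m ((hj _ e).trans hm.symm)

theorem σ₃_mulVec (u : Fin 2 → ℂ) : σ₃ *ᵥ u = ![u 0, -u 1] := by
  funext a
  fin_cases a <;> simp [σ₃, Matrix.mulVec, dotProduct]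

theorem vecMul_σ₃ (u : Fin 2 → ℂ) : u ᵥ* σ₃ = ![u 0, -u 1] := by
  funext a
  fin_cases a <;> simp [σ₃, Matrix.vecMul, dotProduct]

theorem rowPair_ne_zero {v : Fin N → Fin 2 → ℂ} (hv : ∀ j, v j ≠ 0) (i : Fin N ⊕ Fin N) :
    rowPair v i ≠ 0 := by
  rcases i with j | j
  · exact hv j
  · intro h
    apply hv j
    simp only [rowPair, Sum.elim_inr, vecMul_σ₃] at h
    have h0 := congrFun h 0
    have h1 := congrFun h 1
    funext a
    fin_cases a <;> simp_all

theorem polePair_swap (k : Fin N → ℂ) (i : Fin N ⊕ Fin N) :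
    polePair k i.swap = -polePair k i := by
  rcases i with j | j <;> simp [polePair]

theorem rowPair_swap (v : Fin N → Fin 2 → ℂ) (i : Fin N ⊕ Fin N) :
    rowPair v i.swap = rowPair v i ᵥ* σ₃ := by
  rcases i with j | j
  · rfl
  · funext a
    fin_cases a <;> simp [rowPair, vecMul_σ₃]

theorem colPair_swap (α : Fin N → Fin 2 → ℂ) (i : Fin N ⊕ Fin N) :
    colPair α i.swap = -(σ₃ *ᵥ colPair α i) := by
  rcases i with j | j
  · rfl
  · simp only [colPair, Sum.swap_inr, Sum.elim_inl, Sum.elim_inr, Matrix.mulVec_neg, σ₃_mulVec,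
      neg_neg]
    funext a
    fin_cases a <;> simp

theorem vecMul_σ₃_dotProduct_star (u u' : Fin 2 → ℂ) :
    (u ᵥ* σ₃) ⬝ᵥ star (u' ᵥ* σ₃) = u ⬝ᵥ star u' := by
  simp [vecMul_σ₃, dotProduct]

/-- The symmetry `D(-k) = σ₃ D(k) σ₃` in terms of the values `D(κ̄_l) w_l†`. -/
theorem dressing_residual_swap (k : Fin N → ℂ) (v : Fin N → Fin 2 → ℂ)
    (β : Fin N ⊕ Fin N → Fin 2 → ℂ) (l : Fin N ⊕ Fin N) :
    star (rowPair v l) + ∑ i, ((rowPair v i ⬝ᵥ star (rowPair v l)) /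
        (conj (polePair k l) - polePair k i)) • -(σ₃ *ᵥ β i.swap) =
      σ₃ *ᵥ (star (rowPair v l.swap) + ∑ i, ((rowPair v i ⬝ᵥ star (rowPair v l.swap)) /
        (conj (polePair k l.swap) - polePair k i)) • β i) := by
  rw [← Equiv.sum_comp (Equiv.sumComm (Fin N) (Fin N)) fun i =>
    ((rowPair v i ⬝ᵥ star (rowPair v l.swap)) / (conj (polePair k l.swap) - polePair k i)) • β i]
  simp only [Equiv.sumComm_apply, rowPair_swap, polePair_swap, vecMul_σ₃_dotProduct_star,
    Matrix.mulVec_add, map_neg]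
  congr 1
  · simp only [vecMul_σ₃, σ₃_mulVec]
    funext a
    fin_cases a <;> simp
  · rw [← Matrix.mulVecLin_apply, map_sum]
    refine Finset.sum_congr rfl fun i _ => ?_
    rw [map_smul, Matrix.mulVecLin_apply, smul_neg, ← neg_smul,
      show -conj (polePair k l) - -polePair k i = -(conj (polePair k l) - polePair k i) by ring,
      div_neg]

theorem IsDressing.swap {k : Fin N → ℂ} {v : Fin N → Fin 2 → ℂ} {β : Fin N ⊕ Fin N → Fin 2 → ℂ}
    (h : IsDressing (polePair k) (rowPair v) β) :
    IsDressing (polePair k) (rowPair v) fun i => -(σ₃ *ᵥ β i.swap) := by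
  intro l
  rw [dressing_residual_swap, h l.swap, Matrix.mulVec_zero]

/-- For columns that respect the reflection `k ↦ -k`, half of the dressing conditions suffice. -/
theorem isDressing_pair_iff {k : Fin N → ℂ} {v α : Fin N → Fin 2 → ℂ} :
    IsDressing (polePair k) (rowPair v) (colPair α) ↔
      ∀ l, star (v l) + ∑ j, (((v j ⬝ᵥ star (v l)) / (conj (k l) - k j)) • α j
        - (((v j ᵥ* σ₃) ⬝ᵥ star (v l)) / (conj (k l) + k j)) • (σ₃ *ᵥ α j)) = 0 := by
  have keyl : ∀ l, star (v l) + ∑ j, (((v j ⬝ᵥ star (v l)) / (conj (k l) - k j)) • α j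
        - (((v j ᵥ* σ₃) ⬝ᵥ star (v l)) / (conj (k l) + k j)) • (σ₃ *ᵥ α j)) =
      star (rowPair v (.inl l)) + ∑ i, ((rowPair v i ⬝ᵥ star (rowPair v (.inl l))) /
      (conj (polePair k (.inl l)) - polePair k i)) • colPair α i := by
    intro l
    rw [Fintype.sum_sum_type, ← Finset.sum_add_distrib]
    simp only [rowPair, colPair, polePair, Sum.elim_inl, Sum.elim_inr, smul_neg, sub_eq_add_neg,
      neg_neg]
  simp only [keyl]
  refine ⟨fun h l => h (.inl l), ?_⟩
  rintro h (l | l)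
  · exact h l
  · have e : colPair α = fun i => -(σ₃ *ᵥ colPair α i.swap) := by
      funext i
      rw [← colPair_swap, Sum.swap_swap]
    rw [e, dressing_residual_swap]
    exact (congrArg (σ₃ *ᵥ ·) (h l)).trans (Matrix.mulVec_zero _)

end Reflection

section System

variable {N : ℕ}

/-- The row `v_j = (b_j, b_j⁻¹) ψ₀⁻¹(x,t,k_j)`. -/
noncomputable def seedRow (k b : Fin N → ℂ) (ψ₀ : ℝ → ℝ → ℂ → Matrix (Fin 2) (Fin 2) ℂ) (x t : ℝ)
    (j : Fin N) : Fin 2 → ℂ :=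
  ![b j, (b j)⁻¹] ᵥ* (ψ₀ x t (k j))⁻¹

variable {k b : Fin N → ℂ} {ψ₀ : ℝ → ℝ → ℂ → Matrix (Fin 2) (Fin 2) ℂ} {x t : ℝ}

theorem rankOne_mulVec (r s b : ℂ) (M : Matrix (Fin 2) (Fin 2) ℂ) (u : Fin 2 → ℂ) :
    rankOne r s b M *ᵥ u = ((![b, b⁻¹] ᵥ* M⁻¹) ⬝ᵥ u) • ![r, s] := by
  rw [rankOne, ← Matrix.mulVec_mulVec, Matrix.vecMulVec_mulVec, Matrix.dotProduct_mulVec,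
    op_smul_eq_smul]

theorem seedRow_ne_zero (hb0 : ∀ j, b j ≠ 0) (hψ : ∀ j, IsUnit (ψ₀ x t (k j))) (j : Fin N) :
    seedRow k b ψ₀ x t j ≠ 0 := by
  intro h
  have h' := congrArg (· ᵥ* ψ₀ x t (k j)) h
  simp only [seedRow, Matrix.vecMul_vecMul, Matrix.zero_vecMul,
    Matrix.nonsing_inv_mul _ ((Matrix.isUnit_iff_isUnit_det _).1 (hψ j)), Matrix.vecMul_one] at h'
  exact hb0 j (congrFun h' 0)

/-- For invertible `2 × 2` matrices, `σ₂ M̄ σ₂` is the transposed inverse up to the determinant, so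
the vector `u_l` is a nonzero multiple of `v_l†`. -/
theorem kernelVec_eq (hψ : ∀ j, IsUnit (ψ₀ x t (k j))) (l : Fin N) :
    kernelVec k b ψ₀ x t l =
      (Complex.I * conj (ψ₀ x t (k l)).det) • star (seedRow k b ψ₀ x t l) := by
  have hd := ((Matrix.isUnit_iff_isUnit_det _).1 (hψ l)).ne_zero
  have hd' : conj (ψ₀ x t (k l)).det ≠ 0 := by simpa using hd
  rw [seedRow, Matrix.inv_def, Ring.inverse_eq_inv', Matrix.vecMul_smul, star_smul, smul_smul,
    star_inv₀, RCLike.star_def, mul_assoc, mul_inv_cancel₀ hd', mul_one, Matrix.adjugate_fin_two]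
  funext a
  fin_cases a <;>
    simp [kernelVec, σ₂, Matrix.mulVec, dotProduct] <;> ring

theorem coeffA_ne_zero (hk0 : ∀ j, k j ≠ 0) (hk : ∀ j l, j ≠ l → k j ^ 2 ≠ k l ^ 2)
    (hkc : ∀ j l, k j ^ 2 ≠ conj (k l) ^ 2) (j : Fin N) : coeffA k j ≠ 0 := by
  refine mul_ne_zero (div_ne_zero (mul_ne_zero two_ne_zero (hk0 j)) (sub_ne_zero.2 (hkc j j)))
    (Finset.prod_ne_zero_iff.2 fun m hm => div_ne_zero (sub_ne_zero.2 ?_) (sub_ne_zero.2 (hkc j m)))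
  exact hk j m (Finset.ne_of_mem_erase hm).symm

/-- The columns `α_j = (r_j, s_j)ᵀ / a_j`. -/
noncomputable def seedCol (k : Fin N → ℂ) (r s : Fin N → ℂ) (j : Fin N) : Fin 2 → ℂ :=
  (1 / coeffA k j) • ![r j, s j]

theorem solvesSystem_iff (hψ : ∀ j, IsUnit (ψ₀ x t (k j))) {r s : Fin N → ℂ} :
    SolvesSystem k b ψ₀ x t r s ↔
      IsDressing (polePair k) (rowPair (seedRow k b ψ₀ x t)) (colPair (seedCol k r s)) := by
  rw [isDressing_pair_iff]
  refine forall_congr' fun l => ?_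
  have hd : Complex.I * conj (ψ₀ x t (k l)).det ≠ 0 :=
    mul_ne_zero Complex.I_ne_zero
      (by simpa using ((Matrix.isUnit_iff_isUnit_det _).1 (hψ l)).ne_zero)
  rw [kernelVec_eq hψ, Matrix.mulVec_smul, ← smul_add, smul_eq_zero_iff_right hd, Matrix.sum_mulVec]
  refine iff_of_eq (congrArg (fun u => star (seedRow k b ψ₀ x t l) + u = 0)
    (Finset.sum_congr rfl fun j _ => ?_))
  rw [Matrix.smul_mulVec, Matrix.sub_mulVec, Matrix.smul_mulVec, Matrix.smul_mulVec, mul_assoc,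
    ← Matrix.mulVec_mulVec, ← Matrix.mulVec_mulVec, rankOne_mulVec, rankOne_mulVec,
    Matrix.dotProduct_mulVec, Matrix.mulVec_smul, seedCol, Matrix.mulVec_smul]
  simp only [seedRow]
  module

/-- The solution of the dressing problem inherits the symmetry under `k ↦ -k` by uniqueness. -/
theorem dressingCol_eq_colPair (hk0 : ∀ j, k j ≠ 0) (hk : ∀ j l, j ≠ l → k j ^ 2 ≠ k l ^ 2)
    (hkc : ∀ j l, k j ^ 2 ≠ conj (k l) ^ 2) {v : Fin N → Fin 2 → ℂ} (hv : ∀ j, v j ≠ 0) :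
    dressingCol (polePair k) (rowPair v) =
      colPair fun j => dressingCol (polePair k) (rowPair v) (.inl j) := by
  have hiff := fun β => isDressing_iff_eq (β := β) (injective_polePair hk0 hk)
    (polePair_ne_conj hkc) (rowPair_ne_zero hv)
  have h := (hiff _).1 ((hiff _).2 rfl).swap
  funext i
  rcases i with j | j
  · rfl
  · exact (congrFun h (.inr j)).symm

/-- The linear system is the dressing condition, whose only solution is `dressingCol`. -/
theorem solvesSystem_iff_eq (hk0 : ∀ j, k j ≠ 0) (hb0 : ∀ j, b j ≠ 0)
    (hk : ∀ j l, j ≠ l → k j ^ 2 ≠ k l ^ 2) (hkc : ∀ j l, k j ^ 2 ≠ conj (k l) ^ 2)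
    (hψ : ∀ j, IsUnit (ψ₀ x t (k j))) {r s : Fin N → ℂ} :
    SolvesSystem k b ψ₀ x t r s ↔
      ∀ j, seedCol k r s j =
        dressingCol (polePair k) (rowPair (seedRow k b ψ₀ x t)) (.inl j) := by
  have hv := seedRow_ne_zero (x := x) (t := t) hb0 hψ
  rw [solvesSystem_iff hψ, isDressing_iff_eq (injective_polePair hk0 hk) (polePair_ne_conj hkc)
    (rowPair_ne_zero hv), dressingCol_eq_colPair hk0 hk hkc hv]
  refine ⟨fun h j => congrFun h (.inl j), fun h => ?_⟩
  rw [funext h]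
  rfl

theorem existsUnique_solvesSystem (hk0 : ∀ j, k j ≠ 0) (hb0 : ∀ j, b j ≠ 0)
    (hk : ∀ j l, j ≠ l → k j ^ 2 ≠ k l ^ 2) (hkc : ∀ j l, k j ^ 2 ≠ conj (k l) ^ 2)
    (hψ : ∀ j, IsUnit (ψ₀ x t (k j))) :
    ∃! rs : (Fin N → ℂ) × (Fin N → ℂ), SolvesSystem k b ψ₀ x t rs.1 rs.2 := by
  have ha := coeffA_ne_zero hk0 hk hkc
  have e : ∀ r s : Fin N → ℂ, SolvesSystem k b ψ₀ x t r s ↔ ∀ j,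
      r j = coeffA k j * dressingCol (polePair k) (rowPair (seedRow k b ψ₀ x t)) (.inl j) 0 ∧
      s j = coeffA k j * dressingCol (polePair k) (rowPair (seedRow k b ψ₀ x t)) (.inl j) 1 := by
    intro r s
    rw [solvesSystem_iff_eq hk0 hb0 hk hkc hψ]
    refine forall_congr' fun j => ?_
    have := ha j
    rw [funext_iff, Fin.forall_fin_two]
    simp only [seedCol, Pi.smul_apply, smul_eq_mul, Matrix.cons_val_zero, Matrix.cons_val_one]
    field_simp
  refine ⟨(_, _), (e _ _).2 fun j => ⟨rfl, rfl⟩, fun rs h => ?_⟩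
  have h' := (e _ _).1 h
  exact Prod.ext (funext fun j => (h' j).1) (funext fun j => (h' j).2)

end System

/-! ### Flows of dressed columns and moments -/

section Flow

variable {ι : Type*} [Fintype ι]

/-- The moment `∑ i, κ_i ^ n β_i w_i`, i.e. the coefficient of `k ^ (-n - 1)` in the expansion of the
Darboux matrix at infinity. -/
noncomputable def moment (κ : ι → ℂ) (w β : ι → Fin 2 → ℂ) (n : ℕ) : Matrix (Fin 2) (Fin 2) ℂ :=
  ∑ i, κ i ^ n • Matrix.vecMulVec (β i) (w i)

/-- The polynomial part at infinity of `k ^ n (D(k) - 1)`, written by Horner's scheme in terms of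
the coefficients `m` of the expansion of `D`. -/
def polyPart (m : ℕ → Matrix (Fin 2) (Fin 2) ℂ) (k : ℂ) : ℕ → Matrix (Fin 2) (Fin 2) ℂ
  | 0 => 0
  | n + 1 => k • polyPart m k n + m n

theorem moment_apply (κ : ι → ℂ) (w β : ι → Fin 2 → ℂ) (n : ℕ) (a b : Fin 2) :
    moment κ w β n a b = ∑ i, κ i ^ n * (β i a * w i b) := by
  simp [moment, Matrix.sum_apply, Matrix.vecMulVec_apply]

theorem polyPart_moment {κ : ι → ℂ} (w β : ι → Fin 2 → ℂ) {k : ℂ} (hk : ∀ i, k - κ i ≠ 0) (n : ℕ) :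
    polyPart (moment κ w β) k n =
      k ^ n • ∑ i, (1 / (k - κ i)) • Matrix.vecMulVec (β i) (w i)
        - ∑ i, (κ i ^ n / (k - κ i)) • Matrix.vecMulVec (β i) (w i) := by
  induction n with
  | zero => simp [polyPart]
  | succ n ih =>
    rw [polyPart, ih, moment, smul_sub, smul_smul, ← pow_succ', sub_add]
    congr 1
    rw [Finset.smul_sum, ← Finset.sum_sub_distrib]
    refine Finset.sum_congr rfl fun i _ => ?_
    have := hk i
    rw [smul_smul, ← sub_smul]
    congr 1
    field_simp
    ring

/-- Polynomial evaluation of the coefficients of a Lax matrix of degree less than `d`. -/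
def laxEval (A : ℕ → Matrix (Fin 2) (Fin 2) ℂ) (d : ℕ) (k : ℂ) : Matrix (Fin 2) (Fin 2) ℂ :=
  ∑ n ∈ Finset.range d, k ^ n • A n

theorem laxEval_mulVec (A : ℕ → Matrix (Fin 2) (Fin 2) ℂ) (d : ℕ) (k : ℂ) (u : Fin 2 → ℂ) :
    laxEval A d k *ᵥ u = ∑ n ∈ Finset.range d, k ^ n • (A n *ᵥ u) := by
  simp only [laxEval, Matrix.sum_mulVec, Matrix.smul_mulVec]

theorem vecMul_laxEval (A : ℕ → Matrix (Fin 2) (Fin 2) ℂ) (d : ℕ) (k : ℂ) (u : Fin 2 → ℂ) :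
    u ᵥ* laxEval A d k = ∑ n ∈ Finset.range d, k ^ n • (u ᵥ* A n) := by
  simp only [laxEval, Matrix.vecMul_sum, Matrix.vecMul_smul]

theorem conjTranspose_laxEval {A : ℕ → Matrix (Fin 2) (Fin 2) ℂ} (hA : ∀ n, (A n)ᴴ = -A n) (d : ℕ)
    (k : ℂ) : (laxEval A d k)ᴴ = -laxEval A d (conj k) := by
  simp [laxEval, Matrix.conjTranspose_sum, hA]

/-- If the rows evolve by `w_i' = -w_i A₀(κ_i)` and the polynomial `A` is such that
`D A₀ - A D` has no polynomial part at infinity, then `β_i' = A(κ_i) β_i`. Indeed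
`D' + D A₀ - A D` is a sum of simple fractions with columns `β_i' - A(κ_i) β_i` that annihilates
every `w_l†` at `κ̄_l`, and the Cauchy matrix is injective. -/
theorem IsDressing.hasDerivAt {κ : ι → ℂ} (hκ : Function.Injective κ)
    (hκc : ∀ i l, κ i ≠ conj (κ l)) {w β : ι → ℝ → Fin 2 → ℂ} {x : ℝ} (hw : ∀ i, w i x ≠ 0)
    (hD : ∀ y, IsDressing κ (fun i => w i y) (fun i => β i y))
    {A A₀ : ℕ → Matrix (Fin 2) (Fin 2) ℂ} {d : ℕ} (hA₀ : ∀ n, (A₀ n)ᴴ = -A₀ n)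
    (hwd : ∀ i, HasDerivAt (w i) (-(w i x ᵥ* laxEval A₀ d (κ i))) x)
    (hβ : ∀ i, DifferentiableAt ℝ (β i) x)
    (hC : ∀ k, ∑ n ∈ Finset.range d,
      (A n * (k ^ n • 1 + polyPart (moment κ (fun i => w i x) (fun i => β i x)) k n)
        - (k ^ n • 1 + polyPart (moment κ (fun i => w i x) (fun i => β i x)) k n) * A₀ n) = 0)
    (i : ι) : HasDerivAt (β i) (laxEval A d (κ i) *ᵥ β i x) x := by
  -- The derivative of `D(κ̄_l) w_l† = 0` is a homogeneous Cauchy system for `β_i' - A(κ_i) β_i`.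
  have hγ : ∀ l, ∑ i, ((w i x ⬝ᵥ star (w l x)) / (conj (κ l) - κ i)) •
      (deriv (β i) x - laxEval A d (κ i) *ᵥ β i x) = 0 := by
    intro l
    have hne : ∀ i, conj (κ l) - κ i ≠ 0 := fun i => sub_ne_zero.2 (hκc i l).symm
    set y := star (w l x) with hy
    set z := conj (κ l) with hz
    set G : ℕ → Matrix (Fin 2) (Fin 2) ℂ := fun n =>
      ∑ i, (κ i ^ n / (z - κ i)) • Matrix.vecMulVec (β i x) (w i x) with hG
    have hGv : ∀ n u, G n *ᵥ u = ∑ i, (κ i ^ n * (w i x ⬝ᵥ u) / (z - κ i)) • β i x := by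
      intro n u
      simp only [hG, Matrix.sum_mulVec, Matrix.smul_mulVec, Matrix.vecMulVec_mulVec,
        op_smul_eq_smul, smul_smul]
      exact Finset.sum_congr rfl fun i _ => by congr 1; ring
    -- `G n` is the sum of simple fractions `∑ i, κ_i ^ n β_i w_i / (z - κ_i)` at `z = κ̄_l`.
    have hpp : ∀ n, polyPart (moment κ (fun i => w i x) (fun i => β i x)) z n =
        z ^ n • G 0 - G n := by
      intro n
      rw [polyPart_moment _ _ hne]
      simp only [hG, pow_zero]
    have hy' : HasDerivAt (fun s => star (w l s)) (laxEval A₀ d z *ᵥ y) x := by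
      have := (hwd l).star
      rwa [star_neg, Matrix.star_vecMul, conjTranspose_laxEval hA₀, Matrix.neg_mulVec, neg_neg]
        at this
    have hsys : y + G 0 *ᵥ y = 0 := by
      rw [hGv]
      simpa only [pow_zero, one_mul] using hD x l
    have hdot : ∀ i, HasDerivAt (fun s => w i s ⬝ᵥ star (w l s))
        (-(w i x ⬝ᵥ (laxEval A₀ d (κ i) *ᵥ y)) + w i x ⬝ᵥ (laxEval A₀ d z *ᵥ y)) x := by
      intro i
      have h1 := hasDerivAt_pi.1 (hwd i)
      have h2 := hasDerivAt_pi.1 hy'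
      rw [Matrix.dotProduct_mulVec, ← neg_dotProduct]
      simp only [dotProduct, ← Finset.sum_add_distrib]
      exact HasDerivAt.fun_sum fun a _ => (h1 a).mul (h2 a)
    have hder : HasDerivAt (fun s => star (w l s) +
        ∑ i, ((w i s ⬝ᵥ star (w l s)) / (z - κ i)) • β i s)
        (laxEval A₀ d z *ᵥ y + ∑ i, (((w i x ⬝ᵥ y) / (z - κ i)) • deriv (β i) x +
          ((-(w i x ⬝ᵥ (laxEval A₀ d (κ i) *ᵥ y)) + w i x ⬝ᵥ (laxEval A₀ d z *ᵥ y)) / (z - κ i)) •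
            β i x)) x :=
      hy'.add (HasDerivAt.fun_sum fun i _ => ((hdot i).div_const _).smul (hβ i).hasDerivAt)
    have h0 : laxEval A₀ d z *ᵥ y + ∑ i, (((w i x ⬝ᵥ y) / (z - κ i)) • deriv (β i) x +
          ((-(w i x ⬝ᵥ (laxEval A₀ d (κ i) *ᵥ y)) + w i x ⬝ᵥ (laxEval A₀ d z *ᵥ y)) / (z - κ i)) •
            β i x) = 0 := by
      have hc : (fun s => star (w l s) + ∑ i, ((w i s ⬝ᵥ star (w l s)) / (z - κ i)) • β i s) =
          fun _ => 0 := funext fun s => hD s l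
      rw [hc] at hder
      exact hder.unique (hasDerivAt_const x 0)
    have e1 : ∑ i, ((w i x ⬝ᵥ (laxEval A₀ d (κ i) *ᵥ y)) / (z - κ i)) • β i x =
        ∑ n ∈ Finset.range d, G n *ᵥ (A₀ n *ᵥ y) := by
      simp only [hGv]
      rw [Finset.sum_comm]
      refine Finset.sum_congr rfl fun i _ => ?_
      rw [laxEval_mulVec, ← Finset.sum_smul, dotProduct_sum, Finset.sum_div]
      simp only [dotProduct_smul, smul_eq_mul]
    have e2 : ∑ i, ((w i x ⬝ᵥ y) / (z - κ i)) • (laxEval A d (κ i) *ᵥ β i x) =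
        ∑ n ∈ Finset.range d, A n *ᵥ (G n *ᵥ y) := by
      simp only [hGv, ← Matrix.mulVecLin_apply, map_sum, map_smul]
      rw [Finset.sum_comm]
      refine Finset.sum_congr rfl fun i _ => ?_
      rw [Matrix.mulVecLin_apply, laxEval_mulVec, Finset.smul_sum]
      refine Finset.sum_congr rfl fun n _ => ?_
      rw [smul_smul, Matrix.mulVecLin_apply]
      congr 1
      ring
    have e3 : ∑ i, ((w i x ⬝ᵥ (laxEval A₀ d z *ᵥ y)) / (z - κ i)) • β i x =
        G 0 *ᵥ (laxEval A₀ d z *ᵥ y) := by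
      rw [hGv]
      simp
    have e4 : ∑ n ∈ Finset.range d, (A n *ᵥ (G n *ᵥ y) - G n *ᵥ (A₀ n *ᵥ y)) +
        (laxEval A₀ d z *ᵥ y + G 0 *ᵥ (laxEval A₀ d z *ᵥ y)) = 0 := by
      have h1 := congrArg (· *ᵥ y) (hC z)
      have h2 := congrArg (laxEval A d z *ᵥ ·) hsys
      simp only [Matrix.sum_mulVec, Matrix.zero_mulVec, hpp] at h1
      simp only [Matrix.mulVec_zero, laxEval_mulVec] at h2
      rw [← sub_eq_zero.2 (h2.trans h1.symm), laxEval_mulVec, ← Matrix.mulVecLin_apply (M := G 0),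
        map_sum, ← Finset.sum_add_distrib, ← Finset.sum_add_distrib, ← Finset.sum_sub_distrib]
      refine Finset.sum_congr rfl fun n _ => ?_
      simp only [Matrix.mulVecLin_apply, Matrix.sub_mulVec, Matrix.add_mulVec, Matrix.mulVec_add,
        Matrix.mulVec_sub, Matrix.smul_mulVec, Matrix.mulVec_smul, ← Matrix.mulVec_mulVec,
        Matrix.one_mulVec]
      module
    simp only [add_div, neg_div, add_smul, neg_smul, Finset.sum_add_distrib,
      Finset.sum_neg_distrib, e1, e3] at h0
    simp only [smul_sub, Finset.sum_sub_distrib, e2]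
    rw [Finset.sum_sub_distrib] at e4
    rw [← sub_eq_zero.2 (h0.trans e4.symm)]
    abel
  have hz : ∀ i, deriv (β i) x - laxEval A d (κ i) *ᵥ β i x = 0 := by
    intro i
    funext a
    refine congrFun (cauchyMatrix_mulVec_eq_zero hκ hκc hw
      (c := fun i => (deriv (β i) x - laxEval A d (κ i) *ᵥ β i x) a) ?_) i
    funext l
    have := congrFun (hγ l) a
    rwa [Finset.sum_apply] at this
  rw [← sub_eq_zero.1 (hz i)]
  exact (hβ i).hasDerivAt

/-- If rows and columns obey the flows of `A₀` and `A`, the moments obey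
`(m n)' = ∑ j, (A_j m (n + j) - m (n + j) A₀_j)`. -/
theorem hasDerivAt_moment {κ : ι → ℂ} {w β : ι → ℝ → Fin 2 → ℂ} {x : ℝ}
    {A A₀ : ℕ → Matrix (Fin 2) (Fin 2) ℂ} {d : ℕ}
    (hwd : ∀ i, HasDerivAt (w i) (-(w i x ᵥ* laxEval A₀ d (κ i))) x)
    (hβ : ∀ i, HasDerivAt (β i) (laxEval A d (κ i) *ᵥ β i x) x) (n : ℕ) (a b : Fin 2) :
    HasDerivAt (fun y => moment κ (fun i => w i y) (fun i => β i y) n a b)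
      ((∑ m ∈ Finset.range d,
        (A m * moment κ (fun i => w i x) (fun i => β i x) (n + m)
          - moment κ (fun i => w i x) (fun i => β i x) (n + m) * A₀ m)) a b) x := by
  simp only [moment_apply]
  have h : HasDerivAt (fun y => ∑ i, κ i ^ n * (β i y a * w i y b))
      (∑ i, κ i ^ n * ((laxEval A d (κ i) *ᵥ β i x) a * w i x b +
        β i x a * (-(w i x ᵥ* laxEval A₀ d (κ i))) b)) x :=
    HasDerivAt.fun_sum fun i _ =>
      ((hasDerivAt_pi.1 (hβ i) a).mul (hasDerivAt_pi.1 (hwd i) b)).const_mul _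
  convert h using 1
  have hm : ∀ m, (A m * moment κ (fun i => w i x) (fun i => β i x) (n + m)
      - moment κ (fun i => w i x) (fun i => β i x) (n + m) * A₀ m) =
      ∑ i, κ i ^ (n + m) • (Matrix.vecMulVec (A m *ᵥ β i x) (w i x) -
        Matrix.vecMulVec (β i x) (w i x ᵥ* A₀ m)) := by
    intro m
    rw [moment, Finset.mul_sum, Finset.sum_mul, ← Finset.sum_sub_distrib]
    simp only [Matrix.mul_smul, Matrix.smul_mul, Matrix.mul_vecMulVec, Matrix.vecMulVec_mul,
      smul_sub]
  simp only [hm]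
  rw [Finset.sum_comm, Matrix.sum_apply]
  refine Finset.sum_congr rfl fun i _ => ?_
  rw [laxEval_mulVec, vecMul_laxEval, Matrix.sum_apply, Pi.neg_apply, Finset.sum_apply,
    Finset.sum_apply, Finset.sum_mul, ← Finset.sum_neg_distrib, Finset.mul_sum,
    ← Finset.sum_add_distrib, Finset.mul_sum]
  refine Finset.sum_congr rfl fun m _ => ?_
  simp only [Matrix.smul_apply, Matrix.sub_apply, Matrix.vecMulVec_apply, Pi.smul_apply,
    smul_eq_mul]
  ring

/-- The first coefficient of a unitary Darboux matrix is anti-Hermitian. -/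
theorem IsDressing.conj_moment_zero {κ : ι → ℂ} (hκc : ∀ i l, κ i ≠ conj (κ l))
    {w β : ι → Fin 2 → ℂ} (h : IsDressing κ w β) (a b : Fin 2) :
    conj (moment κ w β 0 b a) = -moment κ w β 0 a b := by
  have hw : ∀ l a, conj (w l a) =
      -∑ i, ((w i ⬝ᵥ star (w l)) / (conj (κ l) - κ i)) * β i a := by
    intro l a
    have := congrFun (h l) a
    simp only [Pi.add_apply, Finset.sum_apply, Pi.smul_apply, smul_eq_mul, Pi.zero_apply,
      Pi.star_apply, RCLike.star_def] at this
    exact eq_neg_of_add_eq_zero_left this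
  have hw' : ∀ l b, w l b =
      -∑ i, conj (((w i ⬝ᵥ star (w l)) / (conj (κ l) - κ i)) * β i b) := by
    intro l b
    rw [← map_sum, ← map_neg, ← hw, Complex.conj_conj]
  have e : ∑ l, conj (β l b) * ∑ i, ((w i ⬝ᵥ star (w l)) / (conj (κ l) - κ i)) * β i a =
      -∑ l, β l a * ∑ i, conj (((w i ⬝ᵥ star (w l)) / (conj (κ l) - κ i)) * β i b) := by
    simp only [Finset.mul_sum]
    rw [Finset.sum_comm, ← Finset.sum_neg_distrib]
    refine Finset.sum_congr rfl fun i _ => ?_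
    rw [← Finset.sum_neg_distrib]
    refine Finset.sum_congr rfl fun l _ => ?_
    have h1 : conj (κ l) - κ i ≠ 0 := sub_ne_zero.2 (hκc i l).symm
    have h2 : κ i - conj (κ l) ≠ 0 := sub_ne_zero.2 (hκc i l)
    simp only [dotProduct, Fin.sum_univ_two, map_mul, map_div₀, map_add, map_sub, Pi.star_apply,
      RCLike.star_def, Complex.conj_conj]
    field_simp
    ring
  simp only [moment_apply, pow_zero, one_mul, map_sum, map_mul]
  calc ∑ l, conj (β l b) * conj (w l a)
      = -∑ l, conj (β l b) * ∑ i, ((w i ⬝ᵥ star (w l)) / (conj (κ l) - κ i)) * β i a := by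
        simp only [hw, mul_neg, Finset.sum_neg_distrib]
    _ = ∑ l, β l a * ∑ i, conj (((w i ⬝ᵥ star (w l)) / (conj (κ l) - κ i)) * β i b) := by
        rw [e, neg_neg]
    _ = -∑ l, β l a * w l b := by
        simp only [hw' _ b, mul_neg, Finset.sum_neg_distrib, neg_neg]

end Flow

section Parity

variable {N : ℕ} (k : Fin N → ℂ) (v α : Fin N → Fin 2 → ℂ)

theorem moment_pair_apply (n : ℕ) (a b : Fin 2) :
    moment (polePair k) (rowPair v) (colPair α) n a b =
      ∑ j, (1 - (-1) ^ n * σ₃ a a * σ₃ b b) * (k j ^ n * (α j a * v j b)) := by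
  rw [moment_apply, Fintype.sum_sum_type, ← Finset.sum_add_distrib]
  refine Finset.sum_congr rfl fun j _ => ?_
  simp only [polePair, rowPair, colPair, Sum.elim_inl, Sum.elim_inr, σ₃_mulVec, vecMul_σ₃]
  rw [neg_pow]
  fin_cases a <;> fin_cases b <;> simp [σ₃] <;> ring

/-- The reflection symmetry makes the moments of even index off-diagonal. -/
theorem moment_pair_even {n : ℕ} (hn : Even n) :
    moment (polePair k) (rowPair v) (colPair α) n =
      !![0, moment (polePair k) (rowPair v) (colPair α) n 0 1;
        moment (polePair k) (rowPair v) (colPair α) n 1 0, 0] := by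
  ext a b
  fin_cases a <;> fin_cases b <;> simp [moment_pair_apply, hn.neg_one_pow, σ₃]

theorem moment_pair_odd {n : ℕ} (hn : Odd n) :
    moment (polePair k) (rowPair v) (colPair α) n =
      !![moment (polePair k) (rowPair v) (colPair α) n 0 0, 0;
        0, moment (polePair k) (rowPair v) (colPair α) n 1 1] := by
  ext a b
  fin_cases a <;> fin_cases b <;> simp [moment_pair_apply, hn.neg_one_pow, σ₃]

end Parity

/-! ### The Lax pair and its dressing -/

section LaxPair

/-- The coefficients of the `x`-part `-i k² σ₃ + U` of the Lax pair as a polynomial in `k`, with `q`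
and `p` standing for the values of `q` and `q̄`. -/
noncomputable def xCoeff (q p : ℂ) : ℕ → Matrix (Fin 2) (Fin 2) ℂ
  | 0 => !![Complex.I / 2 * q * p, 0; 0, -(Complex.I / 2 * q * p)]
  | 1 => !![0, q; -p, 0]
  | 2 => !![-Complex.I, 0; 0, Complex.I]
  | _ => 0

/-- The coefficients of the `t`-part `-2 i k⁴ σ₃ + V` of the Lax pair as a polynomial in `k`, with
`q`, `p`, `q₁`, `p₁` standing for the values of `q`, `q̄`, `q_x`, `q̄_x`. -/
noncomputable def tCoeff (q p q₁ p₁ : ℂ) : ℕ → Matrix (Fin 2) (Fin 2) ℂ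
  | 0 => !![(q * p₁ - q₁ * p) / 2 + Complex.I / 4 * q ^ 2 * p ^ 2, 0;
      0, -((q * p₁ - q₁ * p) / 2 + Complex.I / 4 * q ^ 2 * p ^ 2)]
  | 1 => !![0, Complex.I * q₁; Complex.I * p₁, 0]
  | n + 2 => (2 : ℂ) • xCoeff q p n

theorem xCoeff_conjTranspose (q : ℂ) (n : ℕ) :
    (xCoeff q (conj q) n)ᴴ = -xCoeff q (conj q) n := by
  match n with
  | 0 | 1 | 2 => ext a b; fin_cases a <;> fin_cases b <;> simp [xCoeff] <;> ring
  | n + 3 => simp [xCoeff]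

theorem tCoeff_conjTranspose (q q₁ : ℂ) (n : ℕ) :
    (tCoeff q (conj q) q₁ (conj q₁) n)ᴴ = -tCoeff q (conj q) q₁ (conj q₁) n := by
  match n with
  | 0 | 1 => ext a b; fin_cases a <;> fin_cases b <;> simp [tCoeff] <;> ring
  | n + 2 => simp [tCoeff, xCoeff_conjTranspose]

theorem σ₃_mul_xCoeff (q p : ℂ) (n : ℕ) :
    σ₃ * xCoeff q p n = (-1 : ℂ) ^ n • (xCoeff q p n * σ₃) := by
  match n with
  | 0 | 1 | 2 => ext a b; fin_cases a <;> fin_cases b <;> simp [xCoeff, σ₃]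
  | n + 3 => simp [xCoeff]

theorem σ₃_mul_tCoeff (q p q₁ p₁ : ℂ) (n : ℕ) :
    σ₃ * tCoeff q p q₁ p₁ n = (-1 : ℂ) ^ n • (tCoeff q p q₁ p₁ n * σ₃) := by
  match n with
  | 0 | 1 => ext a b; fin_cases a <;> fin_cases b <;> simp [tCoeff, σ₃]
  | n + 2 => simp [tCoeff, σ₃_mul_xCoeff, pow_succ, smul_smul, mul_comm]

theorem laxEval_xCoeff (q : ℝ → ℝ → ℂ) (x t : ℝ) (k : ℂ) :
    laxEval (xCoeff (q x t) (conj (q x t))) 3 k =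
      laxU q x t k - (Complex.I * k ^ 2) • σ₃ := by
  ext a b
  fin_cases a <;> fin_cases b <;>
    simp [laxEval, Finset.sum_range_succ, xCoeff, laxU, potQ, σ₃, pow_two] <;> ring

theorem laxEval_tCoeff {q : ℝ → ℝ → ℂ} {x t : ℝ} {q₁ : ℂ}
    (hq : HasDerivAt (fun y => q y t) q₁ x) (k : ℂ) :
    laxEval (tCoeff (q x t) (conj (q x t)) q₁ (conj q₁)) 5 k =
      laxV q x t k - (2 * Complex.I * k ^ 4) • σ₃ := by
  have hc : HasDerivAt (fun y => -conj (q y t)) (-conj q₁) x := hq.star.neg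
  have hQ : potQx q x t = !![0, q₁; -conj q₁, 0] := by
    ext a b
    fin_cases a <;> fin_cases b <;> simp [potQx, potQ, dx, hq.deriv, -deriv.fun_neg', hc.deriv]
  have hQ2 : potQ q x t ^ 2 = !![-(q x t * conj (q x t)), 0; 0, -(q x t * conj (q x t))] := by
    rw [pow_two, potQ]
    ext a b
    fin_cases a <;> fin_cases b <;> simp [mul_comm]
  have hQ4 : potQ q x t ^ 4 =
      !![(q x t * conj (q x t)) ^ 2, 0; 0, (q x t * conj (q x t)) ^ 2] := by
    rw [show 4 = 2 + 2 from rfl, pow_add, hQ2]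
    ext a b
    fin_cases a <;> fin_cases b <;> simp [pow_two]
  rw [laxV, hQ4, hQ2, hQ]
  simp only [laxEval, Finset.sum_range_succ, Finset.sum_range_zero, tCoeff, xCoeff, potQ, σ₃]
  ext a b
  fin_cases a <;> fin_cases b <;> simp <;> ring

variable {N : ℕ}

theorem σ₃_mul_laxEval {A : ℕ → Matrix (Fin 2) (Fin 2) ℂ}
    (hA : ∀ n, σ₃ * A n = (-1 : ℂ) ^ n • (A n * σ₃)) (d : ℕ) (k : ℂ) :
    σ₃ * laxEval A d (-k) = laxEval A d k * σ₃ := by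
  simp only [laxEval, Finset.mul_sum, Finset.sum_mul, Matrix.mul_smul, Matrix.smul_mul, hA,
    smul_smul]
  refine Finset.sum_congr rfl fun n _ => ?_
  rw [← mul_pow]
  simp

theorem hasDerivAt_rowPair {k : Fin N → ℂ} {v : Fin N → ℝ → Fin 2 → ℂ} {x : ℝ}
    {A : ℕ → Matrix (Fin 2) (Fin 2) ℂ} (hA : ∀ n, σ₃ * A n = (-1 : ℂ) ^ n • (A n * σ₃)) {d : ℕ}
    (hv : ∀ j, HasDerivAt (v j) (-(v j x ᵥ* laxEval A d (k j))) x) (i : Fin N ⊕ Fin N) :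
    HasDerivAt (fun y => rowPair (fun j => v j y) i)
      (-(rowPair (fun j => v j x) i ᵥ* laxEval A d (polePair k i))) x := by
  rcases i with j | j
  · exact hv j
  · simp only [rowPair, polePair, Sum.elim_inr]
    rw [Matrix.vecMul_vecMul, σ₃_mul_laxEval hA, ← Matrix.vecMul_vecMul, ← Matrix.neg_vecMul]
    simp only [vecMul_σ₃]
    have h := hasDerivAt_pi.1 (hv j)
    refine hasDerivAt_pi.2 fun a => ?_
    fin_cases a
    · exact h 0
    · exact (h 1).neg

/-- If `Ψ` solves the Lax equation at `k̄`, then the rows of `Ψ†` solve the adjoint equation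
at `k`. -/
theorem hasDerivAt_vecMul_conjTranspose {A : ℕ → Matrix (Fin 2) (Fin 2) ℂ}
    (hA : ∀ n, (A n)ᴴ = -A n) {d : ℕ} {k : ℂ} (c : Fin 2 → ℂ)
    {Ψ : ℝ → Matrix (Fin 2) (Fin 2) ℂ} {x : ℝ}
    (h : ∀ i j, HasDerivAt (fun y => Ψ y i j) ((laxEval A d (conj k) * Ψ x) i j) x) :
    HasDerivAt (fun y => c ᵥ* (Ψ y)ᴴ) (-((c ᵥ* (Ψ x)ᴴ) ᵥ* laxEval A d k)) x := by
  have e : -((c ᵥ* (Ψ x)ᴴ) ᵥ* laxEval A d k) = c ᵥ* (laxEval A d (conj k) * Ψ x)ᴴ := by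
    rw [Matrix.conjTranspose_mul, conjTranspose_laxEval hA, Complex.conj_conj, Matrix.mul_neg,
      Matrix.vecMul_neg, Matrix.vecMul_vecMul]
  rw [e]
  refine hasDerivAt_pi.2 fun a => ?_
  simp only [Matrix.vecMul, dotProduct, Matrix.conjTranspose_apply]
  exact HasDerivAt.fun_sum fun i _ => (h a i).star.const_mul (c i)

end LaxPair

section DressedPair

variable (A B m : ℕ → Matrix (Fin 2) (Fin 2) ℂ)

/-- The coefficients of the polynomial part at infinity of `D A D⁻¹`, for a quadratic polynomial
with coefficients `A` and `D = 1 + ∑ n, m n / k ^ (n + 1)`. -/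
def dressX : ℕ → Matrix (Fin 2) (Fin 2) ℂ
  | 0 => A 0 + (m 0 * A 1 - (A 1 + (m 0 * A 2 - A 2 * m 0)) * m 0) + (m 1 * A 2 - A 2 * m 1)
  | 1 => A 1 + (m 0 * A 2 - A 2 * m 0)
  | 2 => A 2
  | _ => 0

/-- The `x`-derivative of the moment `m n` under the dressed flow. -/
def evolX (n : ℕ) : Matrix (Fin 2) (Fin 2) ℂ :=
  ∑ j ∈ Finset.range 3, (dressX A m j * m (n + j) - m (n + j) * A j)

/-- The coefficients of the polynomial part at infinity of `D B D⁻¹`, for a quartic polynomial with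
coefficients `B` whose three upper coefficients are twice those of `A`. By that relation the
moments `m 2` and `m 3` enter only through the `x`-derivatives of `m 0` and `m 1`. -/
def dressT : ℕ → Matrix (Fin 2) (Fin 2) ℂ
  | 0 => B 0 - (2 : ℂ) • evolX A m 1 - (B 1 - (2 : ℂ) • evolX A m 0) * m 0 + m 0 * B 1
  | 1 => B 1 - (2 : ℂ) • evolX A m 0
  | n + 2 => (2 : ℂ) • dressX A m n

variable {A B m}

/-- The polynomial part at infinity of `A' D - D A` vanishes, where `A'` is the dressed polynomial. -/
theorem dressX_condition (k : ℂ) :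
    ∑ n ∈ Finset.range 3, (dressX A m n * (k ^ n • 1 + polyPart m k n)
      - (k ^ n • 1 + polyPart m k n) * A n) = 0 := by
  simp only [Finset.sum_range_succ, Finset.sum_range_zero, polyPart, dressX, mul_add, add_mul,
    sub_mul, smul_add, smul_zero, Matrix.mul_smul, Matrix.smul_mul, mul_one, one_mul,
    mul_zero, zero_mul, mul_assoc]
  module

/-- The analogue of `dressX_condition` for the quartic polynomial; its upper part is `2 k²` times that
condition. -/
theorem dressT_condition (hB : ∀ n < 3, B (n + 2) = (2 : ℂ) • A n) (k : ℂ) :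
    ∑ n ∈ Finset.range 5, (dressT A B m n * (k ^ n • 1 + polyPart m k n)
      - (k ^ n • 1 + polyPart m k n) * B n) = 0 := by
  have hx := dressX_condition (A := A) (m := m) k
  simp only [Finset.sum_range_succ, Finset.sum_range_zero, polyPart, dressT, hB 0 (by norm_num),
    hB 1 (by norm_num), hB 2 (by norm_num), evolX, mul_add, add_mul,
    sub_mul, smul_add, smul_zero, Matrix.mul_smul, Matrix.smul_mul, mul_one, one_mul,
    mul_zero, zero_mul, mul_assoc] at hx ⊢
  linear_combination (norm := module) (2 * k ^ 2) • hx

/-- The `t`-derivative of `m 0` under the dressed flow, with the highest moments eliminated. -/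
theorem dressT_evol (hB : ∀ n < 3, B (n + 2) = (2 : ℂ) • A n) :
    ∑ j ∈ Finset.range 5, (dressT A B m j * m (0 + j) - m (0 + j) * B j) =
      (2 : ℂ) • evolX A m 2 + (dressT A B m 1 * m 1 - m 1 * B 1)
        + (dressT A B m 0 * m 0 - m 0 * B 0) := by
  simp only [Finset.sum_range_succ, Finset.sum_range_zero, hB 0 (by norm_num),
    hB 1 (by norm_num), hB 2 (by norm_num), evolX]
  simp only [dressT, Matrix.mul_smul, Matrix.smul_mul, zero_add, add_zero, Nat.reduceAdd]
  module

end DressedPair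

/-! ### The scalar equations -/

section Scalars

/-- The value of `evolX` at `n = 0` for moments that are alternately off-diagonal and diagonal. -/
theorem evolX_zero (q p d e f g h l : ℂ) {m : ℕ → Matrix (Fin 2) (Fin 2) ℂ}
    (h0 : m 0 = !![0, d; e, 0]) (h1 : m 1 = !![f, 0; 0, g]) (h2 : m 2 = !![0, h; l, 0]) :
    evolX (xCoeff q p) m 0 =
      !![0, (Complex.I * q * p - d * p - (q + 2 * Complex.I * d) * e) * d
            + (q + 2 * Complex.I * d) * g - f * q - 2 * Complex.I * h;
        (-(Complex.I * q * p) + e * q + (p + 2 * Complex.I * e) * d) * e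
            - (p + 2 * Complex.I * e) * f + g * p + 2 * Complex.I * l, 0] := by
  simp only [evolX, Finset.sum_range_succ, Finset.sum_range_zero, dressX, xCoeff, zero_add, h0, h1,
    h2]
  ext a b
  fin_cases a <;> fin_cases b <;> simp <;> ring

theorem evolX_one (q p d e f g h l u v : ℂ) {m : ℕ → Matrix (Fin 2) (Fin 2) ℂ}
    (h0 : m 0 = !![0, d; e, 0]) (h1 : m 1 = !![f, 0; 0, g]) (h2 : m 2 = !![0, h; l, 0])
    (h3 : m 3 = !![u, 0; 0, v]) :
    evolX (xCoeff q p) m 1 =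
      !![-(d * p + (q + 2 * Complex.I * d) * e) * f + (q + 2 * Complex.I * d) * l + h * p, 0;
        0, (e * q + (p + 2 * Complex.I * e) * d) * g - (p + 2 * Complex.I * e) * h - l * q] := by
  simp only [evolX, Finset.sum_range_succ, Finset.sum_range_zero, dressX, xCoeff, zero_add, h0, h1,
    h2, h3, Nat.reduceAdd]
  ext a b
  fin_cases a <;> fin_cases b <;> simp <;> ring

/-- The Gerdjikov–Ivanov equation for `q + 2 i d`, with conjugate `p + 2 i e`, given that for `q`. The
letters stand for the entries of the moments `m 0 = !![0, d; e, 0]`, `m 1 = !![f, 0; 0, g]`,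
`m 2 = !![0, h; l, 0]`, with indices `₁`, `₂` for `x`-derivatives; `dt` is the `t`-derivative
of `d`. -/
theorem gi_identity {q p q₁ p₁ q₂ qt d e f g h l h₁ d₁ e₁ f₁ g₁ d₂ dt : ℂ}
    (hq : Complex.I * qt + q₂ - Complex.I * q ^ 2 * p₁ + (1 / 2 : ℂ) * q ^ 3 * p ^ 2 = 0)
    (hd₁ : d₁ = (Complex.I * q * p - d * p - (q + 2 * Complex.I * d) * e) * d
      + (q + 2 * Complex.I * d) * g - f * q - 2 * Complex.I * h)
    (he₁ : e₁ = (-(Complex.I * q * p) + e * q + (p + 2 * Complex.I * e) * d) * e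
      - (p + 2 * Complex.I * e) * f + g * p + 2 * Complex.I * l)
    (hf₁ : f₁ = -(d * p + (q + 2 * Complex.I * d) * e) * f + (q + 2 * Complex.I * d) * l + h * p)
    (hg₁ : g₁ = (e * q + (p + 2 * Complex.I * e) * d) * g - (p + 2 * Complex.I * e) * h - l * q)
    (hd₂ : d₂ = (Complex.I * q₁ * p + Complex.I * q * p₁ - (d₁ * p + d * p₁)
        - ((q₁ + 2 * Complex.I * d₁) * e + (q + 2 * Complex.I * d) * e₁)) * d
      + (Complex.I * q * p - d * p - (q + 2 * Complex.I * d) * e) * d₁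
      + ((q₁ + 2 * Complex.I * d₁) * g + (q + 2 * Complex.I * d) * g₁) - (f₁ * q + f * q₁)
      - 2 * Complex.I * h₁)
    (hdt : dt = 2 * h₁ + ((Complex.I * q₁ - 2 * d₁) * g - f * (Complex.I * q₁))
      + (-2 * f₁ - (Complex.I * q₁ - 2 * d₁) * e + d * (Complex.I * p₁)
        + 2 * ((q * p₁ - q₁ * p) / 2 + Complex.I / 4 * q ^ 2 * p ^ 2)) * d) :
    Complex.I * (qt + 2 * Complex.I * dt) + (q₂ + 2 * Complex.I * d₂)
      - Complex.I * (q + 2 * Complex.I * d) ^ 2 * (p₁ + 2 * Complex.I * e₁)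
      + (1 / 2 : ℂ) * (q + 2 * Complex.I * d) ^ 3 * (p + 2 * Complex.I * e) ^ 2 = 0 := by
  rw [← hq, ← sub_eq_zero]
  -- Reducing the powers of `I` before the remaining substitutions keeps the polynomials small.
  subst hdt hd₂
  ring_nf
  simp only [Complex.I_sq, Complex.I_pow_three, Complex.I_pow_four,
    show Complex.I ^ 5 = Complex.I by rw [pow_succ, Complex.I_pow_four, one_mul]]
  subst hf₁ hg₁ he₁ hd₁
  ring_nf
  simp only [Complex.I_sq]
  ring_nf

end Scalars

/-! ### Dressed solutions -/

section Dressed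

variable {N : ℕ}

/-- The `(1, 2)` entry of the part of `dressT_evol` that contains no derivative of `m 2`. -/
theorem dressT_zero_one {q p q₁ p₁ d e f g d₁ e₁ f₁ g₁ : ℂ} {m : ℕ → Matrix (Fin 2) (Fin 2) ℂ}
    (h0 : m 0 = !![0, d; e, 0]) (h1 : m 1 = !![f, 0; 0, g])
    (hx0 : evolX (xCoeff q p) m 0 = !![0, d₁; e₁, 0])
    (hx1 : evolX (xCoeff q p) m 1 = !![f₁, 0; 0, g₁]) :
    ((dressT (xCoeff q p) (tCoeff q p q₁ p₁) m 1 * m 1 - m 1 * tCoeff q p q₁ p₁ 1)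
      + (dressT (xCoeff q p) (tCoeff q p q₁ p₁) m 0 * m 0 - m 0 * tCoeff q p q₁ p₁ 0)) 0 1 =
      ((Complex.I * q₁ - 2 * d₁) * g - f * (Complex.I * q₁))
      + (-2 * f₁ - (Complex.I * q₁ - 2 * d₁) * e + d * (Complex.I * p₁)
        + 2 * ((q * p₁ - q₁ * p) / 2 + Complex.I / 4 * q ^ 2 * p ^ 2)) * d := by
  simp only [dressT, hx0, hx1, h0, h1, tCoeff]
  simp
  ring

theorem hasDerivAt_slice_x {F : ℝ → ℝ → ℂ} (hF : ContDiff ℝ ∞ fun p : ℝ × ℝ => F p.1 p.2)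
    (x t : ℝ) : HasDerivAt (fun y => F y t) (dx F x t) x :=
  ((hF.comp (contDiff_id.prodMk contDiff_const)).differentiable (by simp) x).hasDerivAt

theorem hasDerivAt_slice_t {F : ℝ → ℝ → ℂ} (hF : ContDiff ℝ ∞ fun p : ℝ × ℝ => F p.1 p.2)
    (x t : ℝ) : HasDerivAt (fun s => F x s) (dt F x t) t :=
  ((hF.comp (contDiff_const.prodMk contDiff_id)).differentiable (by simp) t).hasDerivAt

theorem hasDerivAt_slice_dx {F : ℝ → ℝ → ℂ} (hF : ContDiff ℝ ∞ fun p : ℝ × ℝ => F p.1 p.2)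
    (x t : ℝ) : HasDerivAt (fun y => dx F y t) (dx (dx F) x t) x := by
  have h : ContDiff ℝ ∞ fun y => F y t := hF.comp (contDiff_id.prodMk contDiff_const)
  exact ((contDiff_infty_iff_deriv.1 h).2.differentiable (by simp) x).hasDerivAt

theorem contDiff_rowPair {v : ℝ → ℝ → Fin N → Fin 2 → ℂ}
    (hv : ∀ j a, ContDiff ℝ ∞ fun p : ℝ × ℝ => v p.1 p.2 j a) (i : Fin N ⊕ Fin N) (a : Fin 2) :
    ContDiff ℝ ∞ fun p : ℝ × ℝ => rowPair (v p.1 p.2) i a := by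
  rcases i with j | j
  · exact hv j a
  · simp only [rowPair, Sum.elim_inr, vecMul_σ₃]
    fin_cases a
    · exact hv j 0
    · exact (hv j 1).neg

theorem eq_offDiag_of_eq {M : Matrix (Fin 2) (Fin 2) ℂ} {a b : ℂ} (h : M = !![0, a; b, 0]) :
    M = !![0, M 0 1; M 1 0, 0] := by
  subst h
  rfl

theorem eq_diag_of_eq {M : Matrix (Fin 2) (Fin 2) ℂ} {a b : ℂ} (h : M = !![a, 0; 0, b]) :
    M = !![M 0 0, 0; 0, M 1 1] := by
  subst h
  rfl

/-- The derivative of the entry of `evolX` at `n = 0` computed in `evolX_zero`. -/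
theorem hasDerivAt_evolX_zero_entry {q p d e f g h : ℝ → ℂ} {x : ℝ} {q₁ p₁ d₁ e₁ f₁ g₁ h₁ : ℂ}
    (hq : HasDerivAt q q₁ x) (hp : HasDerivAt p p₁ x) (hd : HasDerivAt d d₁ x)
    (he : HasDerivAt e e₁ x) (hf : HasDerivAt f f₁ x) (hg : HasDerivAt g g₁ x)
    (hh : HasDerivAt h h₁ x) :
    HasDerivAt (fun y => (Complex.I * q y * p y - d y * p y
        - (q y + 2 * Complex.I * d y) * e y) * d y
        + (q y + 2 * Complex.I * d y) * g y - f y * q y - 2 * Complex.I * h y)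
      ((Complex.I * q₁ * p x + Complex.I * q x * p₁ - (d₁ * p x + d x * p₁)
          - ((q₁ + 2 * Complex.I * d₁) * e x + (q x + 2 * Complex.I * d x) * e₁)) * d x
        + (Complex.I * q x * p x - d x * p x - (q x + 2 * Complex.I * d x) * e x) * d₁
        + ((q₁ + 2 * Complex.I * d₁) * g x + (q x + 2 * Complex.I * d x) * g₁)
        - (f₁ * q x + f x * q₁) - 2 * Complex.I * h₁) x := by
  have hQ := hq.add (hd.const_mul (2 * Complex.I))
  exact ((((((((hq.const_mul Complex.I).mul hp).sub (hd.mul hp)).sub (hQ.mul he)).mul hd).add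
    (hQ.mul hg)).sub (hf.mul hq)).sub (hh.const_mul (2 * Complex.I)))

/-- Dressing a solution `q₀` by rows that solve the adjoint Lax pair at the poles `k_j` gives the
solution `q₀ + 2 i (m 0)₁₂`, where `m 0` is the first moment of the Darboux matrix. -/
theorem isGISolution_dressed {k : Fin N → ℂ} (hk0 : ∀ j, k j ≠ 0)
    (hk : ∀ j l, j ≠ l → k j ^ 2 ≠ k l ^ 2) (hkc : ∀ j l, k j ^ 2 ≠ conj (k l) ^ 2)
    {q₀ : ℝ → ℝ → ℂ} (hq₀ : IsGISolution q₀) {v : ℝ → ℝ → Fin N → Fin 2 → ℂ}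
    (hv0 : ∀ x t j, v x t j ≠ 0) (hvs : ∀ j a, ContDiff ℝ ∞ fun p : ℝ × ℝ => v p.1 p.2 j a)
    (hvx : ∀ x t j, HasDerivAt (fun y => v y t j)
      (-(v x t j ᵥ* laxEval (xCoeff (q₀ x t) (conj (q₀ x t))) 3 (k j))) x)
    (hvt : ∀ x t j, HasDerivAt (fun s => v x s j)
      (-(v x t j ᵥ* laxEval (tCoeff (q₀ x t) (conj (q₀ x t)) (dx q₀ x t) (conj (dx q₀ x t))) 5
        (k j))) t) :
    IsGISolution fun x t => q₀ x t + 2 * Complex.I *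
      moment (polePair k) (rowPair (v x t)) (dressingCol (polePair k) (rowPair (v x t))) 0 0 1 := by
  have hκ := injective_polePair hk0 hk
  have hκc := polePair_ne_conj hkc
  have hw := fun x t => rowPair_ne_zero (hv0 x t)
  set β : ℝ → ℝ → Fin N ⊕ Fin N → Fin 2 → ℂ := fun x t =>
    dressingCol (polePair k) (rowPair (v x t)) with hβ
  have hD : ∀ x t, IsDressing (polePair k) (rowPair (v x t)) (β x t) := fun x t =>
    (isDressing_iff_eq hκ hκc (hw x t)).2 rfl
  have hws := contDiff_rowPair hvs
  have hβs : ∀ i a, ContDiff ℝ ∞ fun p : ℝ × ℝ => β p.1 p.2 i a :=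
    contDiff_dressingCol hκ hκc (fun p => hw p.1 p.2) hws
  set m : ℝ → ℝ → ℕ → Matrix (Fin 2) (Fin 2) ℂ := fun x t =>
    moment (polePair k) (rowPair (v x t)) (β x t) with hm
  have hms : ∀ n a b, ContDiff ℝ ∞ fun p : ℝ × ℝ => m p.1 p.2 n a b := by
    intro n a b
    simp only [hm, moment_apply]
    exact ContDiff.sum fun i _ => contDiff_const.mul ((hβs i a).mul (hws i b))
  have hcol : ∀ x t, β x t = colPair fun j => β x t (.inl j) := fun x t =>
    dressingCol_eq_colPair hk0 hk hkc (hv0 x t)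
  have heven : ∀ x t n, Even n → m x t n = !![0, m x t n 0 1; m x t n 1 0, 0] := by
    intro x t n hn
    have h := moment_pair_even k (v x t) (fun j => β x t (.inl j)) hn
    rwa [← hcol] at h
  have hodd : ∀ x t n, Odd n → m x t n = !![m x t n 0 0, 0; 0, m x t n 1 1] := by
    intro x t n hn
    have h := moment_pair_odd k (v x t) (fun j => β x t (.inl j)) hn
    rwa [← hcol] at h
  have hβx : ∀ x t i, DifferentiableAt ℝ (fun y => β y t i) x := fun x t i =>
    differentiableAt_pi.2 fun a =>
      (hasDerivAt_slice_x (F := fun x t => β x t i a) (hβs i a) x t).differentiableAt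
  have hβt : ∀ x t i, DifferentiableAt ℝ (fun s => β x s i) t := fun x t i =>
    differentiableAt_pi.2 fun a =>
      (hasDerivAt_slice_t (F := fun x t => β x t i a) (hβs i a) x t).differentiableAt
  have hmx : ∀ x t n a b, HasDerivAt (fun y => m y t n a b)
      (evolX (xCoeff (q₀ x t) (conj (q₀ x t))) (m x t) n a b) x := by
    intro x t
    have hwd := hasDerivAt_rowPair (σ₃_mul_xCoeff _ _) (hvx x t)
    exact hasDerivAt_moment (w := fun i y => rowPair (v y t) i) (β := fun i y => β y t i) hwd
      (IsDressing.hasDerivAt hκ hκc (hw x t) (fun y => hD y t) (xCoeff_conjTranspose _) hwd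
        (hβx x t) dressX_condition)
  have hmt : ∀ x t a b, HasDerivAt (fun s => m x s 0 a b) ((∑ j ∈ Finset.range 5,
      (dressT (xCoeff (q₀ x t) (conj (q₀ x t)))
          (tCoeff (q₀ x t) (conj (q₀ x t)) (dx q₀ x t) (conj (dx q₀ x t))) (m x t) j * m x t (0 + j)
        - m x t (0 + j) *
          tCoeff (q₀ x t) (conj (q₀ x t)) (dx q₀ x t) (conj (dx q₀ x t)) j)) a b) t := by
    intro x t
    have hwd := hasDerivAt_rowPair (σ₃_mul_tCoeff _ _ _ _) (hvt x t)
    exact hasDerivAt_moment (w := fun i s => rowPair (v x s) i) (β := fun i s => β x s i) hwd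
      (IsDressing.hasDerivAt hκ hκc (hw x t) (fun s => hD x s) (tCoeff_conjTranspose _ _) hwd
        (hβt x t) (dressT_condition fun _ _ => rfl)) 0
  -- The two entries of the first moment determine the new potential and its conjugate.
  have hconj : ∀ x t, conj (q₀ x t + 2 * Complex.I * m x t 0 0 1) =
      conj (q₀ x t) + 2 * Complex.I * m x t 0 1 0 := by
    intro x t
    have := (hD x t).conj_moment_zero hκc 1 0
    simp only [map_add, map_mul, Complex.conj_I, map_ofNat, hm, this]
    ring
  have hev0 := fun x t => evolX_zero (q₀ x t) (conj (q₀ x t)) _ _ _ _ _ _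
    (heven x t 0 (by decide)) (hodd x t 1 (by decide)) (heven x t 2 (by decide))
  have hev1 := fun x t => evolX_one (q₀ x t) (conj (q₀ x t)) _ _ _ _ _ _ _ _
    (heven x t 0 (by decide)) (hodd x t 1 (by decide)) (heven x t 2 (by decide))
    (hodd x t 3 (by decide))
  have hqs := hq₀.smooth
  suffices h : IsGISolution fun x t => q₀ x t + 2 * Complex.I * m x t 0 0 1 from h
  refine ⟨hqs.add (contDiff_const.mul (hms 0 0 1)), fun x t => ?_⟩
  have hqx := hasDerivAt_slice_x hqs
  have hpx : ∀ x t, HasDerivAt (fun y => conj (q₀ y t)) (conj (dx q₀ x t)) x := fun x t =>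
    (hqx x t).star
  have hq := hqx x t
  have hp := hpx x t
  have hd := hmx x t 0 0 1
  have he := hmx x t 0 1 0
  have hf := hmx x t 1 0 0
  have hg := hmx x t 1 1 1
  have hh := hmx x t 2 0 1
  have hx0 := hev0 x t
  have hx1 := hev1 x t
  -- The dressed flow expresses `d_x` through the moments, which can be differentiated once more.
  have hdd : HasDerivAt (fun y => evolX (xCoeff (q₀ y t) (conj (q₀ y t))) (m y t) 0 0 1) _ x :=
    (funext fun y => congrFun (congrFun (hev0 y t) 0) 1).symm ▸
      hasDerivAt_evolX_zero_entry hq hp hd he hf hg hh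
  have hdx : dx (fun x t => q₀ x t + 2 * Complex.I * m x t 0 0 1) = fun x t =>
      dx q₀ x t + 2 * Complex.I * evolX (xCoeff (q₀ x t) (conj (q₀ x t))) (m x t) 0 0 1 := by
    funext x t
    exact ((hqx x t).add ((hmx x t 0 0 1).const_mul _)).deriv
  have hdxx : dx (dx fun x t => q₀ x t + 2 * Complex.I * m x t 0 0 1) x t = _ :=
    (congrArg (fun F => dx F x t) hdx).trans
      ((hasDerivAt_slice_dx hqs x t).add (hdd.const_mul _)).deriv
  have hdt : dt (fun x t => q₀ x t + 2 * Complex.I * m x t 0 0 1) x t = _ :=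
    ((hasDerivAt_slice_t hqs x t).add ((hmt x t 0 1).const_mul _)).deriv
  have hdp : dx (fun x t => conj (q₀ x t + 2 * Complex.I * m x t 0 0 1)) x t = _ :=
    (congrArg (fun F => dx F x t) (funext fun x => funext fun t => hconj x t)).trans
      (hp.add (he.const_mul _)).deriv
  have hGI := hq₀.equation x t
  rw [show dx (fun y s => conj (q₀ y s)) x t = conj (dx q₀ x t) from hp.deriv] at hGI
  rw [hdxx, hdt, hdp, hconj]
  refine gi_identity (f := m x t 1 0 0) (g := m x t 1 1 1) (h := m x t 2 0 1) (l := m x t 2 1 0)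
    (h₁ := evolX (xCoeff (q₀ x t) (conj (q₀ x t))) (m x t) 2 0 1)
    (d₁ := evolX (xCoeff (q₀ x t) (conj (q₀ x t))) (m x t) 0 0 1)
    (f₁ := evolX (xCoeff (q₀ x t) (conj (q₀ x t))) (m x t) 1 0 0)
    (g₁ := evolX (xCoeff (q₀ x t) (conj (q₀ x t))) (m x t) 1 1 1) hGI
    (congrFun (congrFun hx0 0) 1) (congrFun (congrFun hx0 1) 0) (congrFun (congrFun hx1 0) 0)
    (congrFun (congrFun hx1 1) 1) rfl ?_
  rw [dressT_evol fun _ _ => rfl, add_assoc, Matrix.add_apply, dressT_zero_one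
    (heven x t 0 (by decide)) (hodd x t 1 (by decide)) (eq_offDiag_of_eq hx0) (eq_diag_of_eq hx1),
    Matrix.smul_apply, smul_eq_mul]
  ring

end Dressed

/-! ### Rows from an eigenfunction -/

section Seed

variable {N : ℕ} {k b : Fin N → ℂ} {q₀ : ℝ → ℝ → ℂ} {S : Set ℂ}
  {ψ₀ : ℝ → ℝ → ℂ → Matrix (Fin 2) (Fin 2) ℂ}

/-- The inverse in `v_j` is an adjoint, so that `v_j` is antilinear in the values of `ψ₀` at `k̄_j`. -/
theorem seedRow_eq (hsymm : HasSymmetries S ψ₀) (hkS : ∀ j, k j ∈ S) (x t : ℝ) (j : Fin N) :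
    seedRow k b ψ₀ x t j = ![b j, (b j)⁻¹] ᵥ* (ψ₀ x t (conj (k j)))ᴴ := by
  rw [seedRow, hsymm.inverse _ (hkS j)]

theorem contDiff_seedRow (hψ₀ : IsEigenfunction q₀ S ψ₀) (hsymm : HasSymmetries S ψ₀)
    (hkS : ∀ j, k j ∈ S) (j : Fin N) (a : Fin 2) :
    ContDiff ℝ ∞ fun p : ℝ × ℝ => seedRow k b ψ₀ p.1 p.2 j a := by
  simp only [seedRow_eq hsymm hkS, Matrix.vecMul, dotProduct, Matrix.conjTranspose_apply]
  exact ContDiff.sum fun i _ => contDiff_const.mul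
    (Complex.conjCLE.contDiff.comp (hψ₀.smooth _ (hsymm.conj_mem _ (hkS j)) a i))

theorem hasDerivAt_seedRow_x (hψ₀ : IsEigenfunction q₀ S ψ₀)
    (hsymm : HasSymmetries S ψ₀) (hkS : ∀ j, k j ∈ S) (x t : ℝ) (j : Fin N) :
    HasDerivAt (fun y => seedRow k b ψ₀ y t j)
      (-(seedRow k b ψ₀ x t j ᵥ* laxEval (xCoeff (q₀ x t) (conj (q₀ x t))) 3 (k j))) x := by
  simp only [seedRow_eq hsymm hkS]
  have hS := hsymm.conj_mem _ (hkS j)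
  refine hasDerivAt_vecMul_conjTranspose (xCoeff_conjTranspose _) _
    (Ψ := fun y => ψ₀ y t (conj (k j))) fun a c => ?_
  rw [laxEval_xCoeff, sub_mul, Matrix.smul_mul, ← eq_sub_of_add_eq (hψ₀.eq_x _ hS x t)]
  exact hasDerivAt_slice_x (F := fun x t => ψ₀ x t (conj (k j)) a c) (hψ₀.smooth _ hS a c) x t

theorem hasDerivAt_seedRow_t (hq₀ : IsGISolution q₀) (hψ₀ : IsEigenfunction q₀ S ψ₀)
    (hsymm : HasSymmetries S ψ₀) (hkS : ∀ j, k j ∈ S) (x t : ℝ) (j : Fin N) :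
    HasDerivAt (fun s => seedRow k b ψ₀ x s j)
      (-(seedRow k b ψ₀ x t j ᵥ* laxEval (tCoeff (q₀ x t) (conj (q₀ x t)) (dx q₀ x t)
        (conj (dx q₀ x t))) 5 (k j))) t := by
  simp only [seedRow_eq hsymm hkS]
  have hS := hsymm.conj_mem _ (hkS j)
  refine hasDerivAt_vecMul_conjTranspose (tCoeff_conjTranspose _ _) _
    (Ψ := fun s => ψ₀ x s (conj (k j))) fun a c => ?_
  rw [laxEval_tCoeff (hasDerivAt_slice_x hq₀.smooth x t), sub_mul, Matrix.smul_mul,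
    ← eq_sub_of_add_eq (hψ₀.eq_t _ hS x t)]
  exact hasDerivAt_slice_t (F := fun x t => ψ₀ x t (conj (k j)) a c) (hψ₀.smooth _ hS a c) x t

/-- The residues at `k_j` and `-k_j` contribute equally to the off-diagonal part of the first
moment. -/
theorem sum_residueA_eq (r s : Fin N → ℂ) (x t : ℝ) :
    2 * ∑ j, residueA k b ψ₀ r s x t j 0 1 =
      moment (polePair k) (rowPair (seedRow k b ψ₀ x t)) (colPair (seedCol k r s)) 0 0 1 := by
  rw [moment_pair_apply, Finset.mul_sum]
  refine Finset.sum_congr rfl fun j _ => ?_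
  simp only [residueA, rankOne, Matrix.vecMulVec_mul, seedRow, seedCol, Matrix.smul_apply,
    Matrix.vecMulVec_apply, Pi.smul_apply, smul_eq_mul, pow_zero]
  simp [σ₃]
  ring

end Seed

end GerdjikovIvanov

theorem proposition1 (N : ℕ) (hN : 0 < N) (k b : Fin N → ℂ)
    (hk0 : ∀ j, k j ≠ 0) (hb0 : ∀ j, b j ≠ 0)
    (hk : ∀ j l, j ≠ l → k j ^ 2 ≠ k l ^ 2)
    (hkc : ∀ j l, k j ^ 2 ≠ (starRingEnd ℂ) (k l) ^ 2)
    (q₀ : ℝ → ℝ → ℂ) (hq₀ : GerdjikovIvanov.IsGISolution q₀)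
    (S : Set ℂ) (hkS : ∀ j, k j ∈ S)
    (ψ₀ : ℝ → ℝ → ℂ → Matrix (Fin 2) (Fin 2) ℂ)
    (hψ₀ : GerdjikovIvanov.IsEigenfunction q₀ S ψ₀)
    (hsymm : GerdjikovIvanov.HasSymmetries S ψ₀) :
    (∀ x t : ℝ, ∃! rs : (Fin N → ℂ) × (Fin N → ℂ),
      GerdjikovIvanov.SolvesSystem k b ψ₀ x t rs.1 rs.2) ∧
    ∀ r s : ℝ → ℝ → Fin N → ℂ,
      (∀ x t : ℝ, GerdjikovIvanov.SolvesSystem k b ψ₀ x t (r x t) (s x t)) →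
      GerdjikovIvanov.IsGISolution (fun x t =>
        q₀ x t + 4 * Complex.I *
          ∑ j : Fin N, GerdjikovIvanov.residueA k b ψ₀ (r x t) (s x t) x t j 0 1) := by
  open GerdjikovIvanov in
  have hψ : ∀ x t j, IsUnit (ψ₀ x t (k j)) := fun x t j => hsymm.invertible _ (hkS j) x t
  refine ⟨fun x t => existsUnique_solvesSystem hk0 hb0 hk hkc (hψ x t), fun r s hrs => ?_⟩
  have hv0 : ∀ x t j, seedRow k b ψ₀ x t j ≠ 0 := fun x t => seedRow_ne_zero hb0 (hψ x t)
  have hcol : ∀ x t, colPair (seedCol k (r x t) (s x t)) =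
      dressingCol (polePair k) (rowPair (seedRow k b ψ₀ x t)) := by
    intro x t
    rw [dressingCol_eq_colPair hk0 hk hkc (hv0 x t),
      funext ((solvesSystem_iff_eq hk0 hb0 hk hkc (hψ x t)).1 (hrs x t))]
  have h := isGISolution_dressed hk0 hk hkc hq₀ hv0 (contDiff_seedRow hψ₀ hsymm hkS)
    (hasDerivAt_seedRow_x hψ₀ hsymm hkS) (hasDerivAt_seedRow_t hq₀ hψ₀ hsymm hkS)
  simp only [← hcol, ← sum_residueA_eq] at h
  convert h using 3
  ring
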